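/- Let $b\in\mathbb R$. For an odd locally integrable kernel $G$ on $\mathbb R$ put $\hat G f(x)=\int_{\mathbb R}G(x-y)f(y)\,dy$ and, for $m$ in the Schwartz space $\mathcal S(\mathbb R)$, $$\hat B=-(b\,m\,\partial_x+m_x)\,\hat G\,(b\,m\,\partial_x+(b-1)m_x).$$ For functionals $F,K$ of $m$ let $\{F,K\}=\int_{\mathbb R}\frac{\delta F}{\delta m}\,\hat B\,\frac{\delta K}{\delta m}\,dx$, where $\frac{\delta F}{\delta m}$ is the smooth function with $\frac{d}{d\varepsilon}F(m+\varepsilon v)|_{\varepsilon=0}=\int\frac{\delta F}{\delta m}v\,dx$ for all $v\in C_c^\infty(\mathbb R)$. Brackets of the fields $m(x)$ are understood as distributions, i.e. after smearing $m(x)$ to $\int\varphi(x)m(x)\,dx$ with $\varphi\in C_c^\infty(\mathbb R)$; the Jacobi identity is $$\{\{m(x),m(y)\},m(z)\}+\text{cyclic}=0\quad\text{for all } m\in\mathcal S(\mathbb R).$$ 1. For every odd locally integrable $G$, the smeared fields and their brackets have variational derivatives in $C_c^\infty(\mathbb R)$, the bracket of smeared fields is antisymmetric, and as distributions (pointwise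 under the integral if $G\in C^2$) $$\{m(x),m(y)\}=G(x-y)m_x(x)m_x(y)+bG'(x-y)\big(m(x)m_x(y)-m(y)m_x(x)\big)-b^2G''(x-y)m(x)m(y).$$ 2. Let $g$ be even and locally integrable and $G(x)=\int_0^x g(t)\,dt$. Then the Jacobi identity holds if and only if $$G'(\alpha)(G(\beta)+G(\gamma))+G'(\beta)(G(\gamma)+G(\alpha))+G'(\gamma)(G(\alpha)+G(\beta))=0\qquad(1)$$ for almost all $(\alpha,\beta,\gamma)$ in the plane $\alpha+\beta+\gamma=0$; if $g$ is continuous, if and only if (1) holds for all $\alpha+\beta+\gamma=0$. 3. Let $g,G$ be as in 2 and suppose that (1) holds almost everywhere on the plane. Let $\alpha+\beta+\gamma=0$. If $G$ is $C^2$ near $\alpha,\beta,\gamma$, then $$G'(\beta)(G'(\alpha)-G'(\gamma))-G''(\gamma)(G(\alpha)+G(\beta))+G''(\alpha)(G(\beta)+G(\gamma))=0,$$ and if $G$ is $C^3$ near $\alpha,\beta,\gamma$, then $$G'''(\beta)(G(\alpha)+G(\gamma))+G''(\gamma)(G'(\alpha)-G'(\beta))-G''(\alpha)(G'(\beta)-G'(\gamma))=0,$$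 $$G'''(\alpha)(G'(\beta)-G'(\gamma))+G'''(\beta)(G'(\gamma)-G'(\alpha))+G'''(\gamma)(G'(\alpha)-G'(\beta))=0.$$ 4. Let $H=\frac1{b-1}\int m\,dx$ if $b\ne1$; if $b=1$ let $H=\int m\log m\,dx$ and consider only $m>0$. Let $g$ be even with $(1+|x|)^{-k}g\in L^1(\mathbb R)$ for some $k\in\mathbb N$, $G(x)=\int_0^xg$ and $u=g*m$. Then $\frac{\delta H}{\delta m}$ exists, $\hat B\frac{\delta H}{\delta m}=-(um_x+bu_xm)$, and $m_t+um_x+bu_xm=0$ has the same solutions $t\mapsto m(t)\in\mathcal S(\mathbb R)$ as $m_t=\hat B\frac{\delta H}{\delta m}$. 5. Let $A,B\in\mathbb R$. If $g(x)=ABe^{-B|x|}$, then $G(x)=\int_0^x g=A\,\mathrm{sgn}(x)(1-e^{-B|x|})$ and the Jacobi identity holds; if $B>0$, the equation $m_t+um_x+bu_xm=0$, $u=g*m$, has the Hamiltonian form described in 4. The Jacobi identity and this Hamiltonian form also hold in the degenerate cases $G(x)=Ax$ (with $g=A$, $u=A\int m\,dx$) and $G(x)=A\,\mathrm{sgn}(x)$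 (with $g=2A\delta$, $u=2Am$). -/

import Mathlib

open MeasureTheory SchwartzMap
open scoped ContDiff

noncomputable section

namespace NonlocalBracket

/-- Convolution on the line, `(k * f)(x) = ∫ k(x - y) f(y) dy`. -/
def conv (k f : ℝ → ℝ) (x : ℝ) : ℝ := ∫ y, k (x - y) * f y

/-- The antiderivative `G(x) = ∫₀ˣ g(t) dt` of a kernel `g`. -/
def antideriv (g : ℝ → ℝ) (x : ℝ) : ℝ := ∫ t in (0 : ℝ)..x, g t

/-- The operator `B̂ = -(b m ∂ + m_x) Ĝ (b m ∂ + (b - 1) m_x)` at the point `m` of phase space,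
applied to a function `f`; here `Ĝ h = G * h`. -/
def Bhat (G : ℝ → ℝ) (b : ℝ) (m : 𝓢(ℝ, ℝ)) (f : ℝ → ℝ) (x : ℝ) : ℝ :=
  -(b * m x * deriv (conv G (fun y => b * m y * deriv f y + (b - 1) * deriv m y * f y)) x
    + deriv m x * conv G (fun y => b * m y * deriv f y + (b - 1) * deriv m y * f y) x)

/-- `η` is a variational derivative `δF/δm` of the functional `F` at `m`: it is smooth, and
`d/dε F(m + ε v) = ∫ η v dx` at `ε = 0` for all smooth compactly supported variations `v`. -/
def HasVarDeriv (F : 𝓢(ℝ, ℝ) → ℝ) (m : 𝓢(ℝ, ℝ)) (η : ℝ → ℝ) : Prop :=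
  ContDiff ℝ ∞ η ∧ ∀ v : 𝓢(ℝ, ℝ), HasCompactSupport v →
    HasDerivAt (fun ε : ℝ => F (m + ε • v)) (∫ x, η x * v x) 0

/-- Variational derivatives are unique. -/
theorem HasVarDeriv.unique {F : 𝓢(ℝ, ℝ) → ℝ} {m : 𝓢(ℝ, ℝ)} {η ζ : ℝ → ℝ}
    (h₁ : HasVarDeriv F m η) (h₂ : HasVarDeriv F m ζ) : η = ζ := by
  have hη := h₁.1.continuous
  have hζ := h₂.1.continuous
  refine (Continuous.ae_eq_iff_eq (volume : Measure ℝ) hη hζ).1 ?_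
  refine ae_eq_of_integral_contDiff_smul_eq hη.locallyIntegrable hζ.locallyIntegrable ?_
  intro v hv hc
  have key := (h₁.2 (hc.toSchwartzMap hv) hc).unique (h₂.2 (hc.toSchwartzMap hv) hc)
  simpa [mul_comm] using key

open Classical in
/-- The variational derivative `δF/δm` at `m` (and `0` if there is none). -/
def varDeriv (F : 𝓢(ℝ, ℝ) → ℝ) (m : 𝓢(ℝ, ℝ)) : ℝ → ℝ :=
  if h : ∃ η, HasVarDeriv F m η then h.choose else 0

theorem HasVarDeriv.varDeriv_eq {F : 𝓢(ℝ, ℝ) → ℝ} {m : 𝓢(ℝ, ℝ)} {η : ℝ → ℝ}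
    (h : HasVarDeriv F m η) : varDeriv F m = η := by
  have hex : ∃ η, HasVarDeriv F m η := ⟨η, h⟩
  rw [varDeriv, dif_pos hex]
  exact hex.choose_spec.unique h

/-- The bracket `{F, K} = ∫ (δF/δm) B̂ (δK/δm) dx` of two functionals, again a functional. -/
def bracket (G : ℝ → ℝ) (b : ℝ) (F K : 𝓢(ℝ, ℝ) → ℝ) : 𝓢(ℝ, ℝ) → ℝ :=
  fun m => ∫ x, varDeriv F m x * Bhat G b m (varDeriv K m) x

/-- Test functions: smooth with compact support. -/
def IsTest (φ : ℝ → ℝ) : Prop := ContDiff ℝ ∞ φ ∧ HasCompactSupport φ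

/-- The field `m(x)` smeared with `φ`, that is the functional `m ↦ ∫ φ(x) m(x) dx`. -/
def field (φ : ℝ → ℝ) : 𝓢(ℝ, ℝ) → ℝ := fun m => ∫ x, φ x * m x

/-- The Jacobi identity `{{m(x), m(y)}, m(z)} + cyclic = 0`, as an identity of distributions in
`x, y, z`: it is tested against `φ(x) ψ(y) χ(z)`, at every point `m` of phase space. -/
def JacobiIdentity (G : ℝ → ℝ) (b : ℝ) : Prop :=
  ∀ φ ψ χ : ℝ → ℝ, IsTest φ → IsTest ψ → IsTest χ → ∀ m : 𝓢(ℝ, ℝ),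
    bracket G b (bracket G b (field φ) (field ψ)) (field χ) m
      + bracket G b (bracket G b (field ψ) (field χ)) (field φ) m
      + bracket G b (bracket G b (field χ) (field φ)) (field ψ) m = 0

/-- The pairing of the distribution `G⁽ᵏ⁾(x - y)` with `f(x) h(y)`. -/
def kernelPair (G : ℝ → ℝ) (k : ℕ) (f h : ℝ → ℝ) : ℝ :=
  (-1) ^ k * ∫ x, ∫ y, G (x - y) * iteratedDeriv k f x * h y

/-- The expression `G(x-y) m_x(x) m_x(y) + b G'(x-y) (m(x) m_x(y) - m(y) m_x(x))
- b² G''(x-y) m(x) m(y)` for `{m(x), m(y)}`, when `G` is twice differentiable. -/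
def bracketKernel (G : ℝ → ℝ) (b : ℝ) (m : 𝓢(ℝ, ℝ)) (x y : ℝ) : ℝ :=
  G (x - y) * deriv m x * deriv m y
    + b * deriv G (x - y) * (m x * deriv m y - m y * deriv m x)
    - b ^ 2 * iteratedDeriv 2 G (x - y) * m x * m y

/-- The same expression as a distribution in `(x, y)`, paired with `φ(x) ψ(y)`. -/
def bracketKernelPair (G : ℝ → ℝ) (b : ℝ) (m : 𝓢(ℝ, ℝ)) (φ ψ : ℝ → ℝ) : ℝ :=
  kernelPair G 0 (fun x => φ x * deriv m x) (fun y => ψ y * deriv m y)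
    + b * (kernelPair G 1 (fun x => φ x * m x) (fun y => ψ y * deriv m y)
      - kernelPair G 1 (fun x => φ x * deriv m x) (fun y => ψ y * m y))
    - b ^ 2 * kernelPair G 2 (fun x => φ x * m x) (fun y => ψ y * m y)

/-- Left-hand side of the three-term functional equation. -/
def fe1 (G : ℝ → ℝ) (α β γ : ℝ) : ℝ :=
  deriv G α * (G β + G γ) + deriv G β * (G γ + G α) + deriv G γ * (G α + G β)

def fe2 (G : ℝ → ℝ) (α β γ : ℝ) : ℝ :=
  deriv G β * (deriv G α - deriv G γ) - iteratedDeriv 2 G γ * (G α + G β)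
    + iteratedDeriv 2 G α * (G β + G γ)

def fe3 (G : ℝ → ℝ) (α β γ : ℝ) : ℝ :=
  iteratedDeriv 3 G β * (G α + G γ) + iteratedDeriv 2 G γ * (deriv G α - deriv G β)
    - iteratedDeriv 2 G α * (deriv G β - deriv G γ)

def fe4 (G : ℝ → ℝ) (α β γ : ℝ) : ℝ :=
  iteratedDeriv 3 G α * (deriv G β - deriv G γ) + iteratedDeriv 3 G β * (deriv G γ - deriv G α)
    + iteratedDeriv 3 G γ * (deriv G α - deriv G β)

/-- The functional equation, at all points of the plane `α + β + γ = 0`. -/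
def FunctionalEq (G : ℝ → ℝ) : Prop := ∀ α β γ : ℝ, α + β + γ = 0 → fe1 G α β γ = 0

/-- The functional equation, at almost all points of the plane `α + β + γ = 0`. -/
def FunctionalEqAE (G : ℝ → ℝ) : Prop :=
  ∀ᵐ p : ℝ × ℝ ∂volume, fe1 G p.1 p.2 (-p.1 - p.2) = 0

/-- `m` solves `m_t + u m_x + b u_x m = 0`, `u = U m`, at the times in `I`. -/
def SolvesIPDE (U : 𝓢(ℝ, ℝ) → ℝ → ℝ) (b : ℝ) (I : Set ℝ) (m : ℝ → 𝓢(ℝ, ℝ)) : Prop :=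
  ∀ t ∈ I, ∀ x : ℝ, DifferentiableAt ℝ (fun s => m s x) t ∧
    deriv (fun s => m s x) t + U (m t) x * deriv (m t) x + b * deriv (U (m t)) x * m t x = 0

/-- `m` solves Hamilton's equation `m_t = B̂ δH/δm` at the times in `I`. -/
def SolvesHamilton (G : ℝ → ℝ) (b : ℝ) (H : 𝓢(ℝ, ℝ) → ℝ) (I : Set ℝ)
    (m : ℝ → 𝓢(ℝ, ℝ)) : Prop :=
  ∀ t ∈ I, ∀ x : ℝ, DifferentiableAt ℝ (fun s => m s x) t ∧
    deriv (fun s => m s x) t = Bhat G b (m t) (varDeriv H (m t)) x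

/-- The set of states on which the Hamiltonian is considered: all of phase space if `b ≠ 1`, the
positive functions if `b = 1`. -/
def admissible (b : ℝ) : Set 𝓢(ℝ, ℝ) := {m | b = 1 → ∀ x, 0 < m x}

open Classical in
/-- `H = (b - 1)⁻¹ ∫ m dx` if `b ≠ 1`, and `H = ∫ m log m dx` if `b = 1`. -/
def hamiltonian (b : ℝ) (m : 𝓢(ℝ, ℝ)) : ℝ :=
  if b = 1 then ∫ x, m x * Real.log (m x) else 1 / (b - 1) * ∫ x, m x

/-- The equation `m_t + u m_x + b u_x m = 0`, `u = U m`, is `m_t = B̂ δH/δm`: the Hamiltonian has a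
variational derivative, the two vector fields agree, and so do the solutions. -/
def HasHamiltonianForm (G : ℝ → ℝ) (b : ℝ) (U : 𝓢(ℝ, ℝ) → ℝ → ℝ) : Prop :=
  (∀ m ∈ admissible b, (∃ η, HasVarDeriv (hamiltonian b) m η) ∧
    ∀ x, Bhat G b m (varDeriv (hamiltonian b) m) x
      = -(U m x * deriv m x + b * deriv (U m) x * m x)) ∧
  ∀ (I : Set ℝ) (m : ℝ → 𝓢(ℝ, ℝ)), (∀ t ∈ I, m t ∈ admissible b) →
    (SolvesIPDE U b I m ↔ SolvesHamilton G b (hamiltonian b) I m)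

/-- `g` is integrable against some inverse power of `1 + |x|`; then `g * m` is defined for every
Schwartz function `m`. -/
def IsTempered (g : ℝ → ℝ) : Prop := ∃ k : ℕ, Integrable (fun x => g x / (1 + |x|) ^ k)

end NonlocalBracket

end

/-!
Write `a_φ = mom b m φ = b m φ' + (b - 1) m' φ` and `U_φ = G * a_φ`. The two first-order factors of
`B̂` are adjoint to each other up to sign, so the bracket of two smeared fields is the quadratic
expression `∫ a_φ (G * a_ψ)` in `m` (`bracket_field_eq`), which is skew because `G` is odd;
integrating by parts gives its kernel, and differentiating it in `m` gives its variational
derivative (`hasVarDeriv_bracket`). In the cyclic sum of double brackets the explicit `m` and `m'`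
recombine into `a_φ`, `a_ψ`, `a_χ`, and the Jacobiator is `-T(a_φ, a_ψ, a_χ)`, where `T` (`triForm`)
is the cyclic sum of `∫ f₁ (U₂ U₃' - U₃ U₂')` with `Uᵢ = G * fᵢ` (`jacobiator_eq_neg_triForm`).

If `G' = g` almost everywhere, `T` has the kernel `G'(α) (G(β) + G(γ)) + cyclic` at
`(α, β, γ) = (x - y, y - z, z - x)`, so the functional equation implies the Jacobi identity. For the
converse take for `m` the function `exp (l x)` on a large interval, and for the test functions
`exp (-l x) φ` and so on. Then `a = b φ' - l φ`, the Jacobiator is a cubic polynomial in `l`, and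
its top coefficient is, up to sign, `T(φ, ψ, χ)` (`triForm_eq_zero_of_jacobi`). This works for every
`b`. So `T` vanishes on all test functions, and the functional equation follows because `T`
determines its kernel (`ae_eq_zero_of_integral_prod_isTest`).

The second- and third-order equations `fe2`, `fe3` are derivatives of the functional equation along
the plane `α + β + γ = 0`. The equation `fe4` does not involve fourth derivatives, so it is not
obtained by differentiating again: multiplied by the three pairwise sums
`G(β) + G(γ)`, `G(γ) + G(α)`, `G(α) + G(β)` it is an algebraic consequence of the others
(`mul_fe4_eq_zero`), and where one of these sums vanishes on an open set `G` is locally constant at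
two of the three points and `fe4` is trivial.

The variational derivative `η` of the Hamiltonian is a constant or `log m + 1`, and in both cases
`mom b m η = m'`. The Hamiltonian form therefore amounts to `G * m' = u`
(`hasHamiltonianForm_of_conv_deriv`), which is integration by parts
(`conv_antideriv_deriv_schwartz`), or the fundamental theorem of calculus when `G = A sgn x`.
-/

noncomputable section

namespace NonlocalBracket

open Filter Topology

/-! ### Test functions -/

theorem IsTest.continuous {φ : ℝ → ℝ} (h : IsTest φ) : Continuous φ := h.1.continuous

theorem IsTest.integrable {φ : ℝ → ℝ} (h : IsTest φ) : Integrable φ :=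
  h.continuous.integrable_of_hasCompactSupport h.2

theorem IsTest.differentiable {φ : ℝ → ℝ} (h : IsTest φ) : Differentiable ℝ φ :=
  h.1.differentiable (by simp)

theorem IsTest.deriv {φ : ℝ → ℝ} (h : IsTest φ) : IsTest (deriv φ) :=
  ⟨(contDiff_infty_iff_deriv.1 h.1).2, h.2.deriv⟩

theorem IsTest.add {φ ψ : ℝ → ℝ} (h : IsTest φ) (h' : IsTest ψ) :
    IsTest (fun x => φ x + ψ x) := ⟨h.1.add h'.1, h.2.add h'.2⟩

theorem IsTest.mul_left {u φ : ℝ → ℝ} (h : IsTest φ) (hu : ContDiff ℝ ∞ u) :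
    IsTest (fun x => u x * φ x) := ⟨hu.mul h.1, h.2.mul_left⟩

theorem IsTest.mul_right {u φ : ℝ → ℝ} (h : IsTest φ) (hu : ContDiff ℝ ∞ u) :
    IsTest (fun x => φ x * u x) := ⟨h.1.mul hu, h.2.mul_right⟩

theorem IsTest.const_mul {φ : ℝ → ℝ} (h : IsTest φ) (c : ℝ) : IsTest (fun x => c * φ x) :=
  h.mul_left contDiff_const

theorem IsTest.sub {φ ψ : ℝ → ℝ} (h : IsTest φ) (h' : IsTest ψ) :
    IsTest (fun x => φ x - ψ x) := ⟨h.1.sub h'.1, h.2.sub h'.2⟩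

theorem contDiff_deriv {u : ℝ → ℝ} (hu : ContDiff ℝ ∞ u) : ContDiff ℝ ∞ (deriv u) :=
  (contDiff_infty_iff_deriv.1 hu).2

/-- Integration by parts against a test function. -/
theorem IsTest.integral_mul_deriv {φ u : ℝ → ℝ} (h : IsTest φ) (hu : ContDiff ℝ ∞ u) :
    ∫ x, φ x * _root_.deriv u x = -∫ x, _root_.deriv φ x * u x :=
  integral_mul_deriv_eq_deriv_mul_of_integrable
    (fun x _ => (h.differentiable x).hasDerivAt)
    (fun x _ => (hu.differentiable (by simp) x).hasDerivAt)
    (h.mul_right (contDiff_deriv hu)).integrable (h.deriv.mul_right hu).integrable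
    (h.mul_right hu).integrable

/-! ### Locally integrable kernels on the plane -/

theorem locallyIntegrable_comp_sub {k : ℝ → ℝ} (hk : LocallyIntegrable k) :
    LocallyIntegrable (fun p : ℝ × ℝ => k (p.1 - p.2)) := by
  refine (locallyIntegrable_iff).2 fun K hK => ?_
  obtain ⟨R, hR⟩ := hK.isBounded.subset_closedBall (0 : ℝ × ℝ)
  have h1 : Integrable ((Set.Icc (-R) R).indicator (fun _ => (1 : ℝ))) :=
    (integrableOn_const (by simp)).integrable_indicator measurableSet_Icc
  have h2 : Integrable ((Set.Icc (-(2 * R)) (2 * R)).indicator k) :=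
    (hk.integrableOn_isCompact isCompact_Icc).integrable_indicator measurableSet_Icc
  have h3 := h1.convolution_integrand (ContinuousLinearMap.mul ℝ ℝ) h2
  refine IntegrableOn.congr_fun (h3.integrableOn (s := K)) ?_ hK.measurableSet
  intro p hp
  have hp' := hR hp
  rw [mem_closedBall_zero_iff, Prod.norm_def, max_le_iff, Real.norm_eq_abs, Real.norm_eq_abs,
    abs_le, abs_le] at hp'
  have e1 : p.2 ∈ Set.Icc (-R) R := hp'.2
  have e2 : p.1 - p.2 ∈ Set.Icc (-(2 * R)) (2 * R) := by
    constructor <;> linarith [hp'.1.1, hp'.1.2, hp'.2.1, hp'.2.2]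
  simp [e1, e2]

theorem locallyIntegrable_comp_fst {k : ℝ → ℝ} (hk : LocallyIntegrable k) :
    LocallyIntegrable (fun p : ℝ × ℝ => k p.1) := by
  refine (locallyIntegrable_iff).2 fun K hK => ?_
  have h1 : IntegrableOn (fun p : ℝ × ℝ => k p.1 * 1) ((Prod.fst '' K) ×ˢ (Prod.snd '' K)) := by
    rw [IntegrableOn, Measure.volume_eq_prod, ← Measure.prod_restrict]
    exact Integrable.mul_prod (f := k) (g := fun _ => (1 : ℝ))
      (hk.integrableOn_isCompact (hK.image continuous_fst))
      (integrableOn_const (hK.image continuous_snd).measure_lt_top.ne)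
  simp only [mul_one] at h1
  exact h1.mono_set fun p hp => ⟨⟨p, hp, rfl⟩, ⟨p, hp, rfl⟩⟩

theorem locallyIntegrable_comp_swap {F : ℝ × ℝ → ℝ} (hF : LocallyIntegrable F) :
    LocallyIntegrable (fun p : ℝ × ℝ => F p.swap) := by
  refine (locallyIntegrable_iff).2 fun K hK => ?_
  have hmp : MeasurePreserving (Prod.swap : ℝ × ℝ → ℝ × ℝ) volume volume :=
    Measure.measurePreserving_swap
  have h := hF.integrableOn_isCompact (hK.image continuous_swap)
  have := (hmp.integrableOn_comp_preimage
    (MeasurableEquiv.prodComm (α := ℝ) (β := ℝ)).measurableEmbedding).2 h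
  refine this.mono_set fun p hp => ⟨p, hp, rfl⟩

theorem hasCompactSupport_prod {f h : ℝ → ℝ} (hf : HasCompactSupport f)
    (hh : HasCompactSupport h) : HasCompactSupport (fun p : ℝ × ℝ => f p.1 * h p.2) := by
  refine HasCompactSupport.intro (hf.isCompact.prod hh.isCompact) fun p hp => ?_
  rw [Set.mem_prod, not_and_or] at hp
  rcases hp with hp | hp
  · simp [image_eq_zero_of_notMem_tsupport hp]
  · simp [image_eq_zero_of_notMem_tsupport hp]

/-- A locally integrable function on the plane is integrable against a product of continuous
functions of compact support. -/
theorem LocallyIntegrable.integrable_prod_mul {F : ℝ × ℝ → ℝ} (hF : LocallyIntegrable F)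
    {f h : ℝ → ℝ} (hf : Continuous f) (hfc : HasCompactSupport f) (hh : Continuous h)
    (hhc : HasCompactSupport h) : Integrable (fun p : ℝ × ℝ => f p.1 * h p.2 * F p) :=
  hF.integrable_smul_left_of_hasCompactSupport (by fun_prop) (hasCompactSupport_prod hfc hhc)

/-! ### Convolution with a test function -/

theorem conv_eq_convolution (k f : ℝ → ℝ) :
    conv k f = MeasureTheory.convolution f k (ContinuousLinearMap.mul ℝ ℝ) volume := by
  ext x
  simp [conv, MeasureTheory.convolution, mul_comm]

theorem conv_contDiff {k f : ℝ → ℝ} (hk : LocallyIntegrable k) (hf : IsTest f) :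
    ContDiff ℝ ∞ (conv k f) := by
  rw [conv_eq_convolution]
  exact hf.2.contDiff_convolution_left (n := ⊤) _ hf.1 hk

theorem hasDerivAt_conv {k f : ℝ → ℝ} (hk : LocallyIntegrable k) (hf : IsTest f) (x : ℝ) :
    HasDerivAt (conv k f) (conv k (deriv f) x) x := by
  rw [conv_eq_convolution, conv_eq_convolution]
  exact hf.2.hasDerivAt_convolution_left _ (hf.1.of_le (by simp)) hk x

theorem deriv_conv {k f : ℝ → ℝ} (hk : LocallyIntegrable k) (hf : IsTest f) :
    deriv (conv k f) = conv k (deriv f) :=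
  funext fun x => (hasDerivAt_conv hk hf x).deriv

theorem conv_integrable {k f : ℝ → ℝ} (hk : LocallyIntegrable k) (hf : IsTest f) (x : ℝ) :
    Integrable (fun y => k (x - y) * f y) := by
  have := (hf.2.convolutionExists_left (ContinuousLinearMap.mul ℝ ℝ) hf.continuous hk x).integrable
  simpa [mul_comm] using this

theorem conv_add {k f h : ℝ → ℝ} (hk : LocallyIntegrable k) (hf : IsTest f) (hh : IsTest h)
    (x : ℝ) : conv k (fun y => f y + h y) x = conv k f x + conv k h x := by
  simp only [conv, mul_add]
  exact integral_add (conv_integrable hk hf x) (conv_integrable hk hh x)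

theorem conv_const_mul (k f : ℝ → ℝ) (c x : ℝ) :
    conv k (fun y => c * f y) x = c * conv k f x := by
  simp only [conv, ← integral_const_mul]
  congr 1; ext y; ring

theorem conv_sub {k f h : ℝ → ℝ} (hk : LocallyIntegrable k) (hf : IsTest f) (hh : IsTest h)
    (x : ℝ) : conv k (fun y => f y - h y) x = conv k f x - conv k h x := by
  simp only [conv, mul_sub]
  exact integral_sub (conv_integrable hk hf x) (conv_integrable hk hh x)

theorem integrable_kernel {k f h : ℝ → ℝ} (hk : LocallyIntegrable k) (hf : IsTest f)
    (hh : IsTest h) : Integrable (fun p : ℝ × ℝ => f p.1 * h p.2 * k (p.1 - p.2)) :=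
  LocallyIntegrable.integrable_prod_mul (locallyIntegrable_comp_sub hk)
    hf.continuous hf.2 hh.continuous hh.2

/-- The adjoint of `f ↦ k * f` is convolution with the reflected kernel. -/
theorem integral_mul_conv {k f h : ℝ → ℝ} (hk : LocallyIntegrable k) (hf : IsTest f)
    (hh : IsTest h) :
    ∫ x, f x * conv k h x = ∫ y, h y * conv (fun t => k (-t)) f y := by
  have h1 : ∫ x, f x * conv k h x = ∫ x, ∫ y, f x * h y * k (x - y) := by
    congr 1; ext x
    rw [conv, ← integral_const_mul]
    congr 1; ext y; ring
  have h2 : ∫ y, h y * conv (fun t => k (-t)) f y = ∫ y, ∫ x, f x * h y * k (x - y) := by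
    congr 1; ext y
    rw [conv, ← integral_const_mul]
    congr 1; ext x
    rw [neg_sub]; ring
  rw [h1, h2]
  exact integral_integral_swap (f := fun x y => f x * h y * k (x - y)) (integrable_kernel hk hf hh)

theorem integral_mul_conv_of_even {k f h : ℝ → ℝ} (hk : LocallyIntegrable k)
    (he : Function.Even k) (hf : IsTest f) (hh : IsTest h) :
    ∫ x, f x * conv k h x = ∫ x, h x * conv k f x := by
  rw [integral_mul_conv hk hf hh]
  simp only [show (fun t => k (-t)) = k from funext he]

theorem integral_mul_conv_of_odd {k f h : ℝ → ℝ} (hk : LocallyIntegrable k)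
    (ho : Function.Odd k) (hf : IsTest f) (hh : IsTest h) :
    ∫ x, f x * conv k h x = -∫ x, h x * conv k f x := by
  rw [integral_mul_conv hk hf hh, ← integral_neg]
  congr 1; ext y
  have : (fun t => k (-t)) = fun t => - k t := funext ho
  rw [this]
  simp [conv, integral_neg]

/-! ### The bracket of two fields -/

/-- The function `b m φ' + (b - 1) m' φ`, so that `B̂ φ = -(b m ∂ + m') (G * mom b m φ)`. -/
def mom (b : ℝ) (m φ : ℝ → ℝ) (y : ℝ) : ℝ := b * m y * deriv φ y + (b - 1) * deriv m y * φ y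

/-- The formal adjoint of `v ↦ mom b v φ`, applied to `w`. -/
def momAdj (b : ℝ) (φ w : ℝ → ℝ) (x : ℝ) : ℝ := deriv φ x * w x - (b - 1) * (φ x * deriv w x)

theorem Bhat_eq (G : ℝ → ℝ) (b : ℝ) (m : 𝓢(ℝ, ℝ)) (f : ℝ → ℝ) (x : ℝ) :
    Bhat G b m f x
      = -(b * m x * deriv (conv G (mom b m f)) x + deriv m x * conv G (mom b m f) x) := rfl

theorem isTest_mom (b : ℝ) {m φ : ℝ → ℝ} (hm : ContDiff ℝ ∞ m) (hφ : IsTest φ) :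
    IsTest (mom b m φ) :=
  (hφ.deriv.mul_left (contDiff_const.mul hm)).add
    (hφ.mul_left (contDiff_const.mul (contDiff_deriv hm)))

theorem isTest_momAdj (b : ℝ) {φ w : ℝ → ℝ} (hφ : IsTest φ) (hw : ContDiff ℝ ∞ w) :
    IsTest (momAdj b φ w) :=
  (hφ.deriv.mul_right hw).sub ((hφ.mul_right (contDiff_deriv hw)).const_mul _)

theorem mom_add_mul (b ε : ℝ) {m v : ℝ → ℝ} (φ : ℝ → ℝ) (hm : ContDiff ℝ ∞ m)
    (hv : ContDiff ℝ ∞ v) (x : ℝ) :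
    mom b (fun y => m y + ε * v y) φ x = mom b m φ x + ε * mom b v φ x := by
  have h : deriv (fun y => m y + ε * v y) x = deriv m x + ε * deriv v x := by
    have h1 := (hm.differentiable (by simp) x).hasDerivAt
    have h2 := (hv.differentiable (by simp) x).hasDerivAt
    exact (h1.add (h2.const_mul ε)).deriv
  simp only [mom, h]; ring

theorem mom_eq_deriv_mul (b : ℝ) {m φ : ℝ → ℝ} (hm : ContDiff ℝ ∞ m) (hφ : IsTest φ) (x : ℝ) :
    mom b m φ x = b * deriv (fun y => φ y * m y) x - φ x * deriv m x := by
  rw [((hφ.differentiable x).hasDerivAt.fun_mul (hm.differentiable (by simp) x).hasDerivAt).deriv,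
    mom]
  ring

theorem integral_mom_mul (b : ℝ) {v φ w : ℝ → ℝ} (hv : ContDiff ℝ ∞ v) (hφ : IsTest φ)
    (hw : ContDiff ℝ ∞ w) : ∫ x, mom b v φ x * w x = ∫ x, momAdj b φ w x * v x := by
  have hφw := hφ.mul_right hw
  have h := hφw.integral_mul_deriv hv
  have hd : ∀ x, deriv (fun y => φ y * w y) x = deriv φ x * w x + φ x * deriv w x := fun x =>
    ((hφ.differentiable x).hasDerivAt.fun_mul (hw.differentiable (by simp) x).hasDerivAt).deriv
  have i1 := ((hφ.deriv.mul_right hw).mul_right hv).integrable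
  have i2 := (hφw.mul_right (contDiff_deriv hv)).integrable
  have i3 := ((hφ.mul_right (contDiff_deriv hw)).mul_right hv).integrable
  have e1 : ∫ x, mom b v φ x * w x = b * (∫ x, deriv φ x * w x * v x)
      + (b - 1) * ∫ x, φ x * w x * deriv v x := by
    rw [← integral_const_mul, ← integral_const_mul,
      ← integral_add (i1.const_mul _) (i2.const_mul _)]
    congr 1; ext x; rw [mom]; ring
  have e2 : ∫ x, momAdj b φ w x * v x = (∫ x, deriv φ x * w x * v x)
      - (b - 1) * ∫ x, φ x * deriv w x * v x := by
    rw [← integral_const_mul, ← integral_sub i1 (i3.const_mul _)]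
    congr 1; ext x; rw [momAdj]; ring
  have e3 : ∫ x, deriv (fun y => φ y * w y) x * v x = (∫ x, deriv φ x * w x * v x)
      + ∫ x, φ x * deriv w x * v x := by
    rw [← integral_add i1 i3]
    congr 1; ext x; rw [hd]; ring
  rw [e1, e2, h, e3]; ring

theorem hasVarDeriv_field {φ : ℝ → ℝ} (hφ : IsTest φ) (m : 𝓢(ℝ, ℝ)) :
    HasVarDeriv (field φ) m φ := by
  refine ⟨hφ.1, fun v _ => ?_⟩
  have h : (fun ε : ℝ => field φ (m + ε • v))
      = fun ε => (∫ x, φ x * m x) + ε * ∫ x, φ x * v x := by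
    ext ε
    rw [field, ← integral_const_mul, ← integral_add (hφ.mul_right (m.smooth ⊤)).integrable
      ((hφ.mul_right (v.smooth ⊤)).integrable.const_mul _)]
    congr 1; ext x
    simp only [add_apply, smul_apply, smul_eq_mul]; ring
  rw [h]
  simpa using ((hasDerivAt_id (0 : ℝ)).mul_const (∫ x, φ x * v x)).const_add (∫ x, φ x * m x)

/-- `∫ η B̂ f` is the pairing of `mom b m η` with `G * mom b m f`: the two first-order factors
of `B̂` are adjoint to each other up to sign. -/
theorem integral_mul_Bhat (b : ℝ) {G η f : ℝ → ℝ} (hG : LocallyIntegrable G) (m : 𝓢(ℝ, ℝ))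
    (hη : IsTest η) (hf : IsTest f) :
    ∫ x, η x * Bhat G b m f x = ∫ x, mom b m η x * conv G (mom b m f) x := by
  have hm : ContDiff ℝ ∞ m := m.smooth ⊤
  have hU : ContDiff ℝ ∞ (conv G (mom b m f)) := conv_contDiff hG (isTest_mom b hm hf)
  have hηm := hη.mul_right hm
  have h := hηm.integral_mul_deriv hU
  have i1 := (hηm.mul_right (contDiff_deriv hU)).integrable
  have i2 := ((hη.mul_right (contDiff_deriv hm)).mul_right hU).integrable
  have i3 := (hηm.deriv.mul_right hU).integrable
  have e1 : ∫ x, η x * Bhat G b m f x = -(b * ∫ x, η x * m x * deriv (conv G (mom b m f)) x)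
      - ∫ x, η x * deriv m x * conv G (mom b m f) x := by
    rw [← integral_const_mul, ← integral_neg, ← integral_sub (i1.const_mul _).fun_neg i2]
    congr 1; ext x
    rw [Bhat_eq]; ring
  rw [e1, h, mul_neg, neg_neg, ← integral_const_mul, ← integral_sub (i3.const_mul _) i2]
  congr 1; ext x
  rw [mom_eq_deriv_mul b hm hη]; ring

theorem bracket_field_eq (b : ℝ) {G φ ψ : ℝ → ℝ} (hG : LocallyIntegrable G) (hφ : IsTest φ)
    (hψ : IsTest ψ) (m : 𝓢(ℝ, ℝ)) :
    bracket G b (field φ) (field ψ) m = ∫ x, mom b m φ x * conv G (mom b m ψ) x := by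
  rw [bracket, (hasVarDeriv_field hφ m).varDeriv_eq, (hasVarDeriv_field hψ m).varDeriv_eq]
  exact integral_mul_Bhat b hG m hφ hψ

theorem bracket_field_skew (b : ℝ) {G φ ψ : ℝ → ℝ} (hG : LocallyIntegrable G)
    (ho : Function.Odd G) (hφ : IsTest φ) (hψ : IsTest ψ) (m : 𝓢(ℝ, ℝ)) :
    bracket G b (field φ) (field ψ) m = -bracket G b (field ψ) (field φ) m := by
  rw [bracket_field_eq b hG hφ hψ, bracket_field_eq b hG hψ hφ]
  exact integral_mul_conv_of_odd hG ho (isTest_mom b (m.smooth ⊤) hφ) (isTest_mom b (m.smooth ⊤) hψ)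

/-! ### The bracket as a distribution -/

theorem kernelPair_eq (G : ℝ → ℝ) (k : ℕ) (f h : ℝ → ℝ) :
    kernelPair G k f h = (-1) ^ k * ∫ x, iteratedDeriv k f x * conv G h x := by
  rw [kernelPair]
  congr 2; ext x
  rw [conv, ← integral_const_mul]
  congr 1; ext y; ring

theorem integral_deriv_mul_conv_eq_neg {k f h : ℝ → ℝ} (hk : LocallyIntegrable k)
    (hf : IsTest f) (hh : IsTest h) :
    ∫ x, deriv f x * conv k h x = -∫ x, f x * conv k (deriv h) x := by
  have := hf.integral_mul_deriv (conv_contDiff hk hh)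
  rw [deriv_conv hk hh] at this
  rw [this, neg_neg]

theorem bracket_field_eq_kernelPair (b : ℝ) {G φ ψ : ℝ → ℝ} (hG : LocallyIntegrable G)
    (hφ : IsTest φ) (hψ : IsTest ψ) (m : 𝓢(ℝ, ℝ)) :
    bracket G b (field φ) (field ψ) m = bracketKernelPair G b m φ ψ := by
  have hm : ContDiff ℝ ∞ m := m.smooth ⊤
  have hm' := contDiff_deriv hm
  have f1 := hφ.mul_right hm
  have f2 := hφ.mul_right hm'
  have h1 := hψ.mul_right hm
  have h2 := hψ.mul_right hm'
  have hmφ : mom b m φ = fun x => b * deriv (fun y => φ y * m y) x - φ x * deriv m x :=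
    funext (mom_eq_deriv_mul b hm hφ)
  have hmψ : mom b m ψ = fun x => b * deriv (fun y => ψ y * m y) x - ψ x * deriv m x :=
    funext (mom_eq_deriv_mul b hm hψ)
  rw [bracket_field_eq b hG hφ hψ, hmφ, hmψ, bracketKernelPair]
  simp only [kernelPair_eq, iteratedDeriv_zero, iteratedDeriv_succ]
  rw [integral_deriv_mul_conv_eq_neg hG f2 h1, integral_deriv_mul_conv_eq_neg hG f1.deriv h1]
  have c1 := conv_contDiff hG h1.deriv
  have c2 := conv_contDiff hG h2
  have i1 := (f1.deriv.mul_right c1).integrable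
  have i2 := (f1.deriv.mul_right c2).integrable
  have i3 := (f2.mul_right c1).integrable
  have i4 := (f2.mul_right c2).integrable
  have key : ∀ x, (b * deriv (fun y => φ y * m y) x - φ x * deriv m x)
      * conv G (fun x => b * deriv (fun y => ψ y * m y) x - ψ x * deriv m x) x
      = b ^ 2 * (deriv (fun y => φ y * m y) x * conv G (deriv fun y => ψ y * m y) x)
        - b * (deriv (fun y => φ y * m y) x * conv G (fun y => ψ y * deriv m y) x)
        - b * (φ x * deriv m x * conv G (deriv fun y => ψ y * m y) x)
        + φ x * deriv m x * conv G (fun y => ψ y * deriv m y) x := fun x => by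
    rw [conv_sub hG (h1.deriv.const_mul b) h2, conv_const_mul]; ring
  simp_rw [key]
  rw [integral_add (((i1.const_mul _).sub' (i2.const_mul _)).sub' (i3.const_mul _)) i4,
    integral_sub ((i1.const_mul _).sub' (i2.const_mul _)) (i3.const_mul _),
    integral_sub (i1.const_mul _) (i2.const_mul _)]
  simp only [integral_const_mul]
  ring

theorem integral_deriv_mul_conv_of_contDiff {k f h : ℝ → ℝ} (hk : ContDiff ℝ 1 k)
    (hf : IsTest f) (hh : IsTest h) :
    ∫ x, deriv f x * conv k h x = -∫ x, f x * conv (deriv k) h x := by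
  have hk' : Continuous (deriv k) := hk.continuous_deriv le_rfl
  rw [integral_mul_conv hk.continuous.locallyIntegrable hf.deriv hh,
    integral_mul_conv hk'.locallyIntegrable hf hh, ← integral_neg]
  congr 1; ext y
  rw [← mul_neg]
  congr 1
  have hd : ∀ x, HasDerivAt (fun x => k (-(y - x))) (deriv k (-(y - x))) x := fun x => by
    have h1 : HasDerivAt (fun x : ℝ => -(y - x)) 1 x := by
      simpa using ((hasDerivAt_id x).const_sub y).fun_neg
    have h2 := (hk.differentiable (by simp) (-(y - x))).hasDerivAt
    simpa [Function.comp_def] using h2.comp x h1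
  have hkc := hk.continuous
  have hfc := hf.continuous
  have hfc' := hf.deriv.continuous
  refine integral_mul_deriv_eq_deriv_mul_of_integrable (u := fun x => k (-(y - x)))
    (fun x _ => hd x) (fun x _ => (hf.differentiable x).hasDerivAt) ?_ ?_ ?_
  · exact (by fun_prop : Continuous _).integrable_of_hasCompactSupport hf.deriv.2.mul_left
  · exact (by fun_prop : Continuous _).integrable_of_hasCompactSupport hf.2.mul_left
  · exact (by fun_prop : Continuous _).integrable_of_hasCompactSupport hf.2.mul_left

theorem bracket_field_eq_integral (b : ℝ) {G φ ψ : ℝ → ℝ} (hG : ContDiff ℝ 2 G)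
    (hφ : IsTest φ) (hψ : IsTest ψ) (m : 𝓢(ℝ, ℝ)) :
    bracket G b (field φ) (field ψ) m = ∫ x, ∫ y, φ x * ψ y * bracketKernel G b m x y := by
  have hm : ContDiff ℝ ∞ m := m.smooth ⊤
  have hm' := contDiff_deriv hm
  have f1 := hφ.mul_right hm
  have f2 := hφ.mul_right hm'
  have h1 := hψ.mul_right hm
  have h2 := hψ.mul_right hm'
  have hG' : ContDiff ℝ 1 (deriv G) := by
    have : ContDiff ℝ (1 + 1) G := by simpa [one_add_one_eq_two] using hG
    exact (contDiff_succ_iff_deriv.1 this).2.2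
  have l0 := hG.continuous.locallyIntegrable (μ := volume)
  have l1 := hG'.continuous.locallyIntegrable (μ := volume)
  have l2 := (hG'.continuous_deriv le_rfl).locallyIntegrable (μ := volume)
  rw [bracket_field_eq_kernelPair b l0 hφ hψ, bracketKernelPair]
  simp only [kernelPair_eq, iteratedDeriv_zero, iteratedDeriv_succ]
  rw [integral_deriv_mul_conv_of_contDiff (hG.of_le (by norm_num)) f1 h2,
    integral_deriv_mul_conv_of_contDiff (hG.of_le (by norm_num)) f2 h1,
    integral_deriv_mul_conv_of_contDiff (hG.of_le (by norm_num)) f1.deriv h1,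
    integral_deriv_mul_conv_of_contDiff hG' f1 h1]
  have i1 := (f2.mul_right (conv_contDiff l0 h2)).integrable
  have i2 := (f1.mul_right (conv_contDiff l1 h2)).integrable
  have i3 := (f2.mul_right (conv_contDiff l1 h1)).integrable
  have i4 := (f1.mul_right (conv_contDiff l2 h1)).integrable
  have key : ∀ x, ∫ y, φ x * ψ y * bracketKernel G b m x y
      = φ x * deriv m x * conv G (fun y => ψ y * deriv m y) x
        + b * (φ x * m x * conv (deriv G) (fun y => ψ y * deriv m y) x)
        - b * (φ x * deriv m x * conv (deriv G) (fun y => ψ y * m y) x)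
        - b ^ 2 * (φ x * m x * conv (deriv (deriv G)) (fun y => ψ y * m y) x) := fun x => by
    have j1 := (conv_integrable l0 h2 x).const_mul (φ x * deriv m x)
    have j2 := (conv_integrable l1 h2 x).const_mul (b * (φ x * m x))
    have j3 := (conv_integrable l1 h1 x).const_mul (b * (φ x * deriv m x))
    have j4 := (conv_integrable l2 h1 x).const_mul (b ^ 2 * (φ x * m x))
    simp only [conv, ← mul_assoc]
    simp only [← mul_assoc] at j1 j2 j3 j4
    simp only [← integral_const_mul, ← mul_assoc]
    rw [← integral_add j1 j2, ← integral_sub (j1.fun_add j2) j3,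
      ← integral_sub ((j1.fun_add j2).sub' j3) j4]
    congr 1; ext y
    simp only [bracketKernel, iteratedDeriv_zero, iteratedDeriv_succ]
    ring
  simp_rw [key]
  rw [integral_sub ((i1.fun_add (i2.const_mul b)).sub' (i3.const_mul b)) (i4.const_mul _),
    integral_sub (i1.fun_add (i2.const_mul b)) (i3.const_mul b), integral_add i1 (i2.const_mul b)]
  simp only [integral_const_mul]
  ring

/-! ### The bracket of three fields -/

/-- The variational derivative at `m` of the bracket of the fields smeared with `φ` and `ψ`. -/
def bracketGrad (G : ℝ → ℝ) (b : ℝ) (m φ ψ : ℝ → ℝ) (x : ℝ) : ℝ :=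
  momAdj b φ (conv G (mom b m ψ)) x - momAdj b ψ (conv G (mom b m φ)) x

theorem isTest_bracketGrad (b : ℝ) {G m φ ψ : ℝ → ℝ} (hG : LocallyIntegrable G)
    (hm : ContDiff ℝ ∞ m) (hφ : IsTest φ) (hψ : IsTest ψ) : IsTest (bracketGrad G b m φ ψ) :=
  (isTest_momAdj b hφ (conv_contDiff hG (isTest_mom b hm hψ))).sub
    (isTest_momAdj b hψ (conv_contDiff hG (isTest_mom b hm hφ)))

theorem hasVarDeriv_bracket (b : ℝ) {G φ ψ : ℝ → ℝ} (hG : LocallyIntegrable G)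
    (ho : Function.Odd G) (hφ : IsTest φ) (hψ : IsTest ψ) (m : 𝓢(ℝ, ℝ)) :
    HasVarDeriv (bracket G b (field φ) (field ψ)) m (bracketGrad G b m φ ψ) := by
  have hm : ContDiff ℝ ∞ m := m.smooth ⊤
  refine ⟨(isTest_bracketGrad b hG hm hφ hψ).1, fun v _ => ?_⟩
  have hv : ContDiff ℝ ∞ v := v.smooth ⊤
  have a1 := isTest_mom b hm hφ
  have a2 := isTest_mom b hm hψ
  have v1 := isTest_mom b hv hφ
  have v2 := isTest_mom b hv hψ
  have i1 := (a1.mul_right (conv_contDiff hG a2)).integrable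
  have i2 := (v1.mul_right (conv_contDiff hG a2)).integrable
  have i3 := (a1.mul_right (conv_contDiff hG v2)).integrable
  have i4 := (v1.mul_right (conv_contDiff hG v2)).integrable
  -- the bracket is a quadratic polynomial in `ε` along the line `m + ε v`
  have h : (fun ε : ℝ => bracket G b (field φ) (field ψ) (m + ε • v))
      = fun ε => (∫ x, mom b m φ x * conv G (mom b m ψ) x)
        + ε * ((∫ x, mom b v φ x * conv G (mom b m ψ) x)
          + ∫ x, mom b m φ x * conv G (mom b v ψ) x)
        + ε ^ 2 * ∫ x, mom b v φ x * conv G (mom b v ψ) x := by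
    ext ε
    have hc : ((m + ε • v : 𝓢(ℝ, ℝ)) : ℝ → ℝ) = fun y => m y + ε * v y := by
      ext y; simp
    rw [bracket_field_eq b hG hφ hψ, hc, ← integral_add i2 i3, ← integral_const_mul,
      ← integral_const_mul, ← integral_add i1 ((i2.fun_add i3).const_mul _),
      ← integral_add (i1.fun_add ((i2.fun_add i3).const_mul _)) (i4.const_mul _)]
    congr 1; ext x
    have e2 : mom b (fun y => m y + ε * v y) ψ = fun x => mom b m ψ x + ε * mom b v ψ x :=
      funext (mom_add_mul b ε ψ hm hv)
    rw [mom_add_mul b ε φ hm hv, e2, conv_add hG a2 (v2.const_mul ε), conv_const_mul]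
    ring
  have hη : ∫ x, bracketGrad G b m φ ψ x * v x
      = (∫ x, mom b v φ x * conv G (mom b m ψ) x)
          + ∫ x, mom b m φ x * conv G (mom b v ψ) x := by
    rw [integral_mul_conv_of_odd hG ho a1 v2, integral_mom_mul b hv hφ (conv_contDiff hG a2),
      integral_mom_mul b hv hψ (conv_contDiff hG a1), ← sub_eq_add_neg, ← integral_sub
      ((isTest_momAdj b hφ (conv_contDiff hG a2)).mul_right hv).integrable
      ((isTest_momAdj b hψ (conv_contDiff hG a1)).mul_right hv).integrable]
    congr 1; ext x
    rw [bracketGrad]; ring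
  rw [h, hη]
  generalize (∫ x, mom b v φ x * conv G (mom b m ψ) x)
    + ∫ x, mom b m φ x * conv G (mom b v ψ) x = c
  have := (((hasDerivAt_id (0 : ℝ)).mul_const c).const_add
    (∫ x, mom b m φ x * conv G (mom b m ψ) x)).fun_add
    (((hasDerivAt_id (0 : ℝ)).pow 2).mul_const (∫ x, mom b v φ x * conv G (mom b v ψ) x))
  simpa using this

/-- The alternating trilinear form `∑ ∫ f₁ (U₂ U₃' - U₃ U₂')`, summed over cyclic permutations,
with `Uᵢ = G * fᵢ`. -/
def triForm (G f₁ f₂ f₃ : ℝ → ℝ) : ℝ :=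
  (∫ x, f₁ x * (conv G f₂ x * deriv (conv G f₃) x - conv G f₃ x * deriv (conv G f₂) x))
    + (∫ x, f₂ x * (conv G f₃ x * deriv (conv G f₁) x - conv G f₁ x * deriv (conv G f₃) x))
    + ∫ x, f₃ x * (conv G f₁ x * deriv (conv G f₂) x - conv G f₂ x * deriv (conv G f₁) x)

theorem triForm_cycle (G f₁ f₂ f₃ : ℝ → ℝ) : triForm G f₁ f₂ f₃ = triForm G f₂ f₃ f₁ := by
  simp only [triForm]; ring

/-- The Jacobiator of three fields depends on `b` and `m` only through `mom b m`: the remaining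
derivatives of the test functions and of `m` recombine into it. -/
theorem jacobiator_eq_neg_triForm (b : ℝ) {G φ ψ χ : ℝ → ℝ} (hG : LocallyIntegrable G)
    (ho : Function.Odd G) (hφ : IsTest φ) (hψ : IsTest ψ) (hχ : IsTest χ) (m : 𝓢(ℝ, ℝ)) :
    bracket G b (bracket G b (field φ) (field ψ)) (field χ) m
      + bracket G b (bracket G b (field ψ) (field χ)) (field φ) m
      + bracket G b (bracket G b (field χ) (field φ)) (field ψ) m
      = -triForm G (mom b m φ) (mom b m ψ) (mom b m χ) := by
  have hm : ContDiff ℝ ∞ m := m.smooth ⊤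
  have hm' := contDiff_deriv hm
  have hB : ∀ {φ ψ χ : ℝ → ℝ}, IsTest φ → IsTest ψ → IsTest χ →
      bracket G b (bracket G b (field φ) (field ψ)) (field χ) m
        = ∫ x, bracketGrad G b m φ ψ x * (-(b * m x * deriv (conv G (mom b m χ)) x
          + deriv m x * conv G (mom b m χ) x)) := fun hφ hψ hχ => by
    rw [bracket, (hasVarDeriv_bracket b hG ho hφ hψ m).varDeriv_eq,
      (hasVarDeriv_field hχ m).varDeriv_eq]
    rfl
  have u1 := conv_contDiff hG (isTest_mom b hm hφ)
  have u2 := conv_contDiff hG (isTest_mom b hm hψ)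
  have u3 := conv_contDiff hG (isTest_mom b hm hχ)
  have hX : ∀ {U : ℝ → ℝ}, ContDiff ℝ ∞ U →
      ContDiff ℝ ∞ (fun x => -(b * m x * deriv U x + deriv m x * U x)) := fun hU =>
    (((contDiff_const.mul hm).mul (contDiff_deriv hU)).add (hm'.mul hU)).neg
  have hY : ∀ {U V : ℝ → ℝ}, ContDiff ℝ ∞ U → ContDiff ℝ ∞ V →
      ContDiff ℝ ∞ (fun x => U x * deriv V x - V x * deriv U x) := fun hU hV =>
    (hU.mul (contDiff_deriv hV)).sub (hV.mul (contDiff_deriv hU))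
  have i1 := ((isTest_bracketGrad b hG hm hφ hψ).mul_right (hX u3)).integrable
  have i2 := ((isTest_bracketGrad b hG hm hψ hχ).mul_right (hX u1)).integrable
  have i3 := ((isTest_bracketGrad b hG hm hχ hφ).mul_right (hX u2)).integrable
  have j1 := ((isTest_mom b hm hφ).mul_right (hY u2 u3)).integrable
  have j2 := ((isTest_mom b hm hψ).mul_right (hY u3 u1)).integrable
  have j3 := ((isTest_mom b hm hχ).mul_right (hY u1 u2)).integrable
  rw [hB hφ hψ hχ, hB hψ hχ hφ, hB hχ hφ hψ, triForm, ← integral_add i1 i2,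
    ← integral_add (i1.fun_add i2) i3, ← integral_add j1 j2, ← integral_add (j1.fun_add j2) j3,
    ← integral_neg]
  congr 1; ext x
  simp only [bracketGrad, momAdj]
  simp only [mom.eq_1 b m φ x, mom.eq_1 b m ψ x, mom.eq_1 b m χ x]
  ring

/-! ### Antiderivatives -/

theorem LocallyIntegrable.intervalIntegrable_real {g : ℝ → ℝ} (hg : LocallyIntegrable g)
    (x y : ℝ) :
    IntervalIntegrable g volume x y :=
  intervalIntegrable_iff.mpr <|
    (hg.integrableOn_isCompact isCompact_uIcc).mono_set Set.uIoc_subset_uIcc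

theorem continuous_antideriv {g : ℝ → ℝ} (hg : LocallyIntegrable g) : Continuous (antideriv g) :=
  intervalIntegral.continuous_primitive (LocallyIntegrable.intervalIntegrable_real hg) 0

theorem antideriv_odd {g : ℝ → ℝ} (he : Function.Even g) : Function.Odd (antideriv g) := by
  intro x
  have h := intervalIntegral.integral_comp_neg (a := 0) (b := x) g
  simp only [he _, neg_zero] at h
  rw [antideriv, antideriv, h, ← intervalIntegral.integral_symm]

theorem ae_deriv_antideriv {g : ℝ → ℝ} (hg : LocallyIntegrable g) :
    ∀ᵐ x, deriv (antideriv g) x = g x := by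
  filter_upwards [LocallyIntegrable.ae_hasDerivAt_integral hg] with x hx
  exact (hx 0).deriv

/-- Integration by parts moves the derivative in `G * f'` to `G`, where `G' = g` only almost
everywhere. -/
theorem conv_antideriv_deriv {g f : ℝ → ℝ} (hg : LocallyIntegrable g) (hf : ContDiff ℝ 1 f) (x : ℝ)
    (h₁ : Integrable (fun t => antideriv g t * deriv f (x - t)))
    (h₂ : Integrable (fun t => g t * f (x - t)))
    (htop : Tendsto (fun t => antideriv g t * f (x - t)) atTop (𝓝 0))
    (hbot : Tendsto (fun t => antideriv g t * f (x - t)) atBot (𝓝 0)) :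
    conv (antideriv g) (deriv f) x = conv g f x := by
  have e₁ : conv (antideriv g) (deriv f) x = ∫ t, antideriv g t * deriv f (x - t) := by
    rw [conv, ← integral_sub_left_eq_self _ volume x]
    simp
  have e₂ : conv g f x = ∫ t, g t * f (x - t) := by
    rw [conv, ← integral_sub_left_eq_self _ volume x]
    simp
  rw [e₁, e₂]
  have hdf : ∀ t, HasDerivAt (fun t => f (x - t)) (-deriv f (x - t)) t := fun t => by
    have h2 := (hf.differentiable (by simp) (x - t)).hasDerivAt
    simpa [Function.comp_def] using h2.comp t ((hasDerivAt_id t).const_sub x)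
  have hI : ∀ R : ℝ, ∫ t in -R..R, antideriv g t * deriv f (x - t)
      = -(antideriv g R * f (x - R) - antideriv g (-R) * f (x - -R))
        + ∫ t in -R..R, g t * f (x - t) := fun R => by
    have ac1 : AbsolutelyContinuousOnInterval (fun t => ∫ s in (-R)..t, g s) (-R) R :=
      (LocallyIntegrable.intervalIntegrable_real hg (-R)
        R).absolutelyContinuousOnInterval_intervalIntegral (by simp)
    have hsplit : antideriv g = fun t => antideriv g (-R) + ∫ s in (-R)..t, g s := by
      ext t
      exact (intervalIntegral.integral_add_adjacent_intervals
        (LocallyIntegrable.intervalIntegrable_real hg _ _)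
        (LocallyIntegrable.intervalIntegrable_real hg _ _)).symm
    have ac : AbsolutelyContinuousOnInterval (antideriv g) (-R) R := by
      rw [hsplit]
      refine AbsolutelyContinuousOnInterval.fun_add ?_ ac1
      exact contDiff_const.contDiffOn.absolutelyContinuousOnInterval
    have ac2 : AbsolutelyContinuousOnInterval (fun t => f (x - t)) (-R) R :=
      (hf.comp (contDiff_const.sub contDiff_id)).contDiffOn.absolutelyContinuousOnInterval
    have key := ac.integral_mul_deriv_eq_deriv_mul ac2
    have hleft : ∫ t in -R..R, antideriv g t * deriv (fun t => f (x - t)) t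
        = -∫ t in -R..R, antideriv g t * deriv f (x - t) := by
      rw [← intervalIntegral.integral_neg]
      congr 1; ext t
      rw [(hdf t).deriv]; ring
    have hright : ∫ t in -R..R, deriv (antideriv g) t * f (x - t)
        = ∫ t in -R..R, g t * f (x - t) := by
      apply intervalIntegral.integral_congr_ae
      filter_upwards [ae_deriv_antideriv hg] with t ht _
      rw [ht]
    rw [hleft, hright] at key
    linarith
  have t1 := intervalIntegral_tendsto_integral h₁ tendsto_neg_atTop_atBot tendsto_id
  have t2 := intervalIntegral_tendsto_integral h₂ tendsto_neg_atTop_atBot tendsto_id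
  have t3 := hbot.comp tendsto_neg_atTop_atBot
  have t4 := (htop.sub t3).neg.add t2
  simp only [id, Function.comp_def, sub_self, neg_zero, zero_add] at t1 t4
  refine tendsto_nhds_unique t1 ?_
  simp_rw [hI]
  exact t4

theorem deriv_conv_antideriv {g f : ℝ → ℝ} (hg : LocallyIntegrable g) (hf : IsTest f) :
    deriv (conv (antideriv g) f) = conv g f := by
  have hc := continuous_antideriv hg
  rw [deriv_conv hc.locallyIntegrable hf]
  ext x
  have hfc := hf.continuous
  have hfc' := hf.deriv.continuous
  have hs : ∀ {h : ℝ → ℝ}, HasCompactSupport h → HasCompactSupport (fun t => h (x - t)) :=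
    fun hh => hh.comp_homeomorph (Homeomorph.subLeft x)
  have hz : Tendsto (fun t => antideriv g t * f (x - t)) (cocompact ℝ) (𝓝 0) :=
    (hs hf.2).mul_left.is_zero_at_infty
  refine conv_antideriv_deriv hg (hf.1.of_le (by simp)) x ?_ ?_ (hz.mono_left atTop_le_cocompact)
    (hz.mono_left atBot_le_cocompact)
  · exact (by fun_prop : Continuous _).integrable_of_hasCompactSupport (hs hf.deriv.2).mul_left
  · exact hg.integrable_smul_right_of_hasCompactSupport (by fun_prop) (hs hf.2)

/-! ### Density of products of test functions -/

/-- A function orthogonal to all test functions of the first variable has zero integral over every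
bounded vertical strip. -/
theorem setIntegral_prod_univ_eq_zero {H : ℝ × ℝ → ℝ}
    (hH : ∀ R : ℝ, IntegrableOn H (Set.Icc (-R) R ×ˢ Set.univ))
    (h : ∀ φ, IsTest φ → ∫ p : ℝ × ℝ, φ p.1 * H p = 0) {A : Set ℝ} {R : ℝ}
    (hAR : A ⊆ Set.Icc (-R) R) : ∫ p in A ×ˢ Set.univ, H p = 0 := by
  have hw : ∀ R : ℝ, IntegrableOn (fun x => ∫ z, H (x, z)) (Set.Icc (-R) R) := fun R => by
    have := hH R
    rw [IntegrableOn, Measure.volume_eq_prod, ← Measure.prod_restrict, Measure.restrict_univ] at this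
    exact this.integral_prod_left
  have hwl : LocallyIntegrable (fun x => ∫ z, H (x, z)) := by
    refine locallyIntegrable_iff.2 fun K hK => ?_
    obtain ⟨R, hR⟩ := hK.isBounded.subset_closedBall (0 : ℝ)
    rw [Real.closedBall_eq_Icc, zero_sub, zero_add] at hR
    exact (hw R).mono_set hR
  have hz : ∀ᵐ x, ∫ z, H (x, z) = 0 := by
    refine ae_eq_zero_of_integral_contDiff_smul_eq_zero hwl fun φ hφ hφc => ?_
    have hφt : IsTest φ := ⟨hφ, hφc⟩
    obtain ⟨R, hR⟩ := hφc.isCompact.isBounded.subset_closedBall (0 : ℝ)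
    rw [Real.closedBall_eq_Icc, zero_sub, zero_add] at hR
    obtain ⟨C, hC⟩ := hφc.exists_bound_of_continuous hφ.continuous
    have hi : Integrable (fun p : ℝ × ℝ => φ p.1 * H p) := by
      have h0 : IntegrableOn (fun p : ℝ × ℝ => φ p.1 * H p) (Set.Icc (-R) R ×ˢ Set.univ) :=
        Integrable.bdd_mul (hH R) (hφ.continuous.comp continuous_fst).aestronglyMeasurable
          (ae_of_all _ fun p => hC p.1)
      refine (integrableOn_iff_integrable_of_support_subset fun p hp => ?_).1 h0
      refine ⟨hR (subset_tsupport _ ?_), trivial⟩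
      exact left_ne_zero_of_mul hp
    rw [← h φ hφt, Measure.volume_eq_prod, integral_prod _ hi]
    simp only [smul_eq_mul, integral_const_mul]
  have hi : IntegrableOn H (A ×ˢ Set.univ) := (hH R).mono_set (Set.prod_mono hAR le_rfl)
  rw [Measure.volume_eq_prod, setIntegral_prod _ hi]
  simp only [Measure.restrict_univ]
  rw [integral_congr_ae (ae_restrict_of_ae hz)]
  simp

/-- A locally integrable function on the plane that is orthogonal to all products of test
functions vanishes almost everywhere: its integrals over rectangles vanish, and rectangles generate
the measurable sets. -/
theorem ae_eq_zero_of_integral_prod_isTest {F : ℝ × ℝ → ℝ} (hF : LocallyIntegrable F)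
    (h : ∀ φ χ, IsTest φ → IsTest χ → ∫ p : ℝ × ℝ, φ p.1 * χ p.2 * F p = 0) :
    ∀ᵐ p, F p = 0 := by
  have int_strip : ∀ {A : Set ℝ} {R : ℝ}, MeasurableSet A → A ⊆ Set.Icc (-R) R → ∀ χ, IsTest χ →
      ∫ p in A ×ˢ Set.univ, χ p.2 * F p = 0 := by
    intro A R hA hAR χ hχ
    refine setIntegral_prod_univ_eq_zero (H := fun p => χ p.2 * F p) (fun R => ?_)
      (fun φ hφ => ?_) hAR
    · obtain ⟨C, hC⟩ := hχ.2.exists_bound_of_continuous hχ.continuous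
      have h0 : IntegrableOn (fun p : ℝ × ℝ => χ p.2 * F p) (Set.Icc (-R) R ×ˢ tsupport χ) :=
        Integrable.bdd_mul (hF.integrableOn_isCompact (isCompact_Icc.prod hχ.2.isCompact))
          (hχ.continuous.comp continuous_snd).aestronglyMeasurable (ae_of_all _ fun p => hC p.2)
      refine h0.of_forall_sdiff_eq_zero (measurableSet_Icc.prod MeasurableSet.univ) fun p hp => ?_
      have : p.2 ∉ tsupport χ := fun h' => hp.2 ⟨hp.1.1, h'⟩
      rw [image_eq_zero_of_notMem_tsupport this, zero_mul]
    · simpa only [mul_assoc] using h φ χ hφ hχ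
  have hmp : MeasurePreserving (Prod.swap : ℝ × ℝ → ℝ × ℝ) volume volume :=
    Measure.measurePreserving_swap
  have hme : MeasurableEmbedding (Prod.swap : ℝ × ℝ → ℝ × ℝ) :=
    (MeasurableEquiv.prodComm (α := ℝ) (β := ℝ)).measurableEmbedding
  have int_rect : ∀ {A B : Set ℝ} {R : ℝ}, MeasurableSet A → A ⊆ Set.Icc (-R) R → MeasurableSet B →
      B ⊆ Set.Icc (-R) R → ∫ p in A ×ˢ B, F p = 0 := by
    intro A B R hA hAR hB hBR
    have hF' := locallyIntegrable_comp_swap hF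
    -- the same argument in the other variable, with the indicator of `A` in place of `φ`
    have key : ∫ q in B ×ˢ Set.univ,
        (Set.univ ×ˢ A).indicator (fun q : ℝ × ℝ => F q.swap) q = 0 := by
      refine setIntegral_prod_univ_eq_zero (fun R' => ?_) (fun χ hχ => ?_) hBR
      · rw [integrableOn_indicator_iff (MeasurableSet.univ.prod hA)]
        refine (hF'.integrableOn_isCompact (isCompact_Icc.prod isCompact_Icc)).mono_set
          (t := Set.Icc (-R') R' ×ˢ Set.Icc (-R) R) ?_
        rintro p ⟨hp1, hp2⟩
        exact ⟨hp2.1, hAR hp1.2⟩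
      · rw [← int_strip hA hAR χ hχ, ← integral_indicator (hA.prod MeasurableSet.univ),
          ← hmp.integral_comp hme]
        congr 1; ext p
        by_cases hp : p.1 ∈ A <;> simp [Set.indicator, Set.mem_prod, hp]
    rw [setIntegral_indicator (MeasurableSet.univ.prod hA)] at key
    rw [← hmp.setIntegral_preimage_emb hme, ← key]
    congr 2
    ext p; simp [and_comm]
  have ae_zero_box : ∀ R : ℝ,
      ∀ᵐ p ∂(volume.restrict (Set.Icc (-R) R ×ˢ Set.Icc (-R) R)), F p = 0 := by
    intro R
    have hi : IntegrableOn F (Set.Icc (-R) R ×ˢ Set.Icc (-R) R) :=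
      hF.integrableOn_isCompact (isCompact_Icc.prod isCompact_Icc)
    refine Integrable.ae_eq_zero_of_forall_setIntegral_eq_zero hi fun s hs _ => ?_
    have hall : ∫ p in Set.Icc (-R) R ×ˢ Set.Icc (-R) R, F p = 0 :=
      int_rect measurableSet_Icc le_rfl measurableSet_Icc le_rfl
    induction s, hs using MeasurableSpace.induction_on_inter generateFrom_prod.symm isPiSystem_prod
      with
    | empty => simp
    | basic s hs =>
      obtain ⟨A, hA, B, hB, rfl⟩ := hs
      have hA : MeasurableSet A := hA
      have hB : MeasurableSet B := hB
      rw [Measure.restrict_restrict (hA.prod hB), Set.prod_inter_prod]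
      exact int_rect (hA.inter measurableSet_Icc) Set.inter_subset_right
        (hB.inter measurableSet_Icc) Set.inter_subset_right
    | compl s hs ih =>
      have := integral_add_compl hs hi
      rw [hall, ih (measure_lt_top_of_subset (Set.subset_univ _) (by
        rw [Measure.restrict_apply_univ]
        exact (isCompact_Icc.prod isCompact_Icc).measure_lt_top.ne))] at this
      linarith
    | iUnion f hd hm ih =>
      rw [integral_iUnion hm hd hi.integrableOn]
      have : ∀ i, ∫ p in f i, F p ∂(volume.restrict (Set.Icc (-R) R ×ˢ Set.Icc (-R) R)) = 0 :=
        fun i => ih i (measure_lt_top_of_subset (Set.subset_univ _) (by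
          rw [Measure.restrict_apply_univ]
          exact (isCompact_Icc.prod isCompact_Icc).measure_lt_top.ne))
      simp only [this, tsum_zero]
  have hall : ∀ᵐ p : ℝ × ℝ, ∀ n : ℕ, p ∈ Set.Icc (-(n : ℝ)) n ×ˢ Set.Icc (-(n : ℝ)) n → F p = 0 :=
    ae_all_iff.2 fun n => (ae_restrict_iff' (measurableSet_Icc.prod measurableSet_Icc)).1
      (ae_zero_box n)
  filter_upwards [hall] with p hp
  obtain ⟨n, hn⟩ := exists_nat_ge (max |p.1| |p.2|)
  refine hp n ⟨abs_le.1 ((le_max_left _ _).trans hn), abs_le.1 ((le_max_right _ _).trans hn)⟩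

open Filter Topology

/-! ### The functional equation -/

/-- The left-hand side of the three-term functional equation, with a function `g` in place of the
derivative of `G`. -/
def threeTerm (G g : ℝ → ℝ) (α β γ : ℝ) : ℝ :=
  g α * (G β + G γ) + g β * (G γ + G α) + g γ * (G α + G β)

/-- The density of the functional `ψ ↦ triForm G φ ψ χ`, where `G' = g` (see `triForm_eq_integral`).
It is the integral of `φ(x) χ(z)` against the functional equation at `(x - y, y - z, z - x)`. -/
def triDensity (G g φ χ : ℝ → ℝ) (y : ℝ) : ℝ :=
  conv G χ y * conv g φ y - conv G φ y * conv g χ y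
    - conv G (fun x => φ x * conv g χ x) y - conv g (fun x => φ x * conv G χ x) y
    + conv g (fun x => χ x * conv G φ x) y + conv G (fun x => χ x * conv g φ x) y

theorem continuous_triDensity {G g φ χ : ℝ → ℝ} (hG : LocallyIntegrable G)
    (hg : LocallyIntegrable g) (hφ : IsTest φ) (hχ : IsTest χ) :
    Continuous (triDensity G g φ χ) := by
  have c : ∀ {k f : ℝ → ℝ}, LocallyIntegrable k → IsTest f → Continuous (conv k f) :=
    fun hk hf => (conv_contDiff hk hf).continuous
  have c1 := c hG hφ
  have c2 := c hG hχ
  have c3 := c hg hφ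
  have c4 := c hg hχ
  have c5 := c hG (hφ.mul_right (conv_contDiff hg hχ))
  have c6 := c hg (hφ.mul_right (conv_contDiff hG hχ))
  have c7 := c hg (hχ.mul_right (conv_contDiff hG hφ))
  have c8 := c hG (hχ.mul_right (conv_contDiff hg hφ))
  unfold triDensity
  fun_prop

theorem triForm_eq_integral {g φ ψ χ : ℝ → ℝ} (he : Function.Even g) (hg : LocallyIntegrable g)
    (hφ : IsTest φ) (hψ : IsTest ψ) (hχ : IsTest χ) :
    triForm (antideriv g) φ ψ χ = ∫ y, ψ y * triDensity (antideriv g) g φ χ y := by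
  have hG := (continuous_antideriv hg).locallyIntegrable (μ := volume)
  have ho := antideriv_odd he
  simp only [triForm, deriv_conv_antideriv hg hφ, deriv_conv_antideriv hg hψ,
    deriv_conv_antideriv hg hχ]
  have c1 := conv_contDiff hG hφ
  have c2 := conv_contDiff hG hχ
  have c3 := conv_contDiff hg hφ
  have c4 := conv_contDiff hg hχ
  have c0 := conv_contDiff hG hψ
  have c0' := conv_contDiff hg hψ
  have t1 := hφ.mul_right c4
  have t2 := hφ.mul_right c2
  have t3 := hχ.mul_right c1
  have t4 := hχ.mul_right c3
  -- the two terms in which `ψ` is convolved, by the symmetry of `g` and the antisymmetry of `G`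
  have e1 : ∫ x, φ x * (conv (antideriv g) ψ x * conv g χ x - conv (antideriv g) χ x * conv g ψ x)
      = -(∫ y, ψ y * conv (antideriv g) (fun x => φ x * conv g χ x) y)
        - ∫ y, ψ y * conv g (fun x => φ x * conv (antideriv g) χ x) y := by
    rw [← integral_mul_conv_of_odd hG ho t1 hψ, ← integral_mul_conv_of_even hg he t2 hψ,
      ← integral_sub (t1.mul_right c0).integrable (t2.mul_right c0').integrable]
    congr 1; ext x; ring
  have e2 : ∫ x, χ x * (conv (antideriv g) φ x * conv g ψ x - conv (antideriv g) ψ x * conv g φ x)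
      = (∫ y, ψ y * conv g (fun x => χ x * conv (antideriv g) φ x) y)
        + ∫ y, ψ y * conv (antideriv g) (fun x => χ x * conv g φ x) y := by
    rw [integral_mul_conv_of_odd hG ho hψ t4, ← sub_eq_add_neg,
      ← integral_mul_conv_of_even hg he t3 hψ,
      ← integral_sub (t3.mul_right c0').integrable (t4.mul_right c0).integrable]
    congr 1; ext x; ring
  have i0 := (hψ.mul_right ((c2.mul c3).sub (c1.mul c4))).integrable
  have i1 := (hψ.mul_right (conv_contDiff hG t1)).integrable
  have i2 := (hψ.mul_right (conv_contDiff hg t2)).integrable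
  have i3 := (hψ.mul_right (conv_contDiff hg t3)).integrable
  have i4 := (hψ.mul_right (conv_contDiff hG t4)).integrable
  rw [e1, e2, ← integral_neg, ← integral_sub i1.fun_neg i2, ← integral_add i3 i4,
    ← integral_add (i1.fun_neg.sub' i2) i0, ← integral_add ((i1.fun_neg.sub' i2).fun_add i0)
      (i3.fun_add i4)]
  congr 1; ext y
  rw [triDensity]; ring

theorem locallyIntegrable_mul_continuous {F C : ℝ × ℝ → ℝ} (hF : LocallyIntegrable F)
    (hC : Continuous C) : LocallyIntegrable (fun p => F p * C p) := by
  rw [← locallyIntegrableOn_univ] at hF ⊢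
  exact hF.mul_continuousOn hC.continuousOn isClosed_univ.isLocallyClosed

theorem locallyIntegrable_comp_sub_const {k : ℝ → ℝ} (hk : LocallyIntegrable k) (y : ℝ) :
    LocallyIntegrable (fun x => k (x - y)) := by
  refine locallyIntegrable_iff.2 fun K hK => ?_
  have h := hk.integrableOn_isCompact (hK.image (continuous_sub_right y))
  have := ((measurePreserving_sub_right (volume : Measure ℝ) y).integrableOn_comp_preimage
    (MeasurableEquiv.subRight y).measurableEmbedding).2 h
  exact this.mono_set (Set.subset_preimage_image _ _)

/-- The six terms of the functional equation at `(x - y, y - z, z - x)` for fixed `y`, as functions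
of `(x, z)`. -/
theorem locallyIntegrable_threeTerm {G g : ℝ → ℝ} (hG : Continuous G) (he : Function.Even g)
    (hg : LocallyIntegrable g) (y : ℝ) :
    LocallyIntegrable (fun p : ℝ × ℝ => g (p.1 - y)) ∧
    LocallyIntegrable (fun p : ℝ × ℝ => g (y - p.2)) ∧
    LocallyIntegrable (fun p : ℝ × ℝ => g (p.2 - p.1)) ∧
    LocallyIntegrable (fun p : ℝ × ℝ => threeTerm G g (p.1 - y) (y - p.2) (p.2 - p.1)) := by
  have h0 := locallyIntegrable_comp_sub_const hg y
  have h1 := locallyIntegrable_comp_fst h0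
  have h2 : LocallyIntegrable (fun p : ℝ × ℝ => g (y - p.2)) := by
    have := locallyIntegrable_comp_swap h1
    refine this.congr (ae_of_all _ fun p => ?_)
    simp only [Prod.fst_swap]
    rw [← he, neg_sub]
  have h3 : LocallyIntegrable (fun p : ℝ × ℝ => g (p.2 - p.1)) :=
    locallyIntegrable_comp_swap (locallyIntegrable_comp_sub hg)
  refine ⟨h1, h2, h3, ?_⟩
  exact ((locallyIntegrable_mul_continuous h1 (by fun_prop)).add
    (locallyIntegrable_mul_continuous h2 (by fun_prop))).add
    (locallyIntegrable_mul_continuous h3 (by fun_prop))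

theorem integral_threeTerm_eq_triDensity {G g φ χ : ℝ → ℝ} (hG : Continuous G)
    (ho : Function.Odd G) (he : Function.Even g) (hg : LocallyIntegrable g) (hφ : IsTest φ)
    (hχ : IsTest χ) (y : ℝ) :
    ∫ p : ℝ × ℝ, φ p.1 * χ p.2 * threeTerm G g (p.1 - y) (y - p.2) (p.2 - p.1)
      = triDensity G g φ χ y := by
  obtain ⟨h1, h2, h3, -⟩ := locallyIntegrable_threeTerm hG he hg y
  have hint : ∀ {F C : ℝ × ℝ → ℝ}, LocallyIntegrable F → Continuous C →
      Integrable (fun p : ℝ × ℝ => φ p.1 * χ p.2 * (F p * C p)) := fun hF hC =>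
    LocallyIntegrable.integrable_prod_mul (locallyIntegrable_mul_continuous hF hC)
      hφ.continuous hφ.2 hχ.continuous hχ.2
  have oG : ∀ s t, G (s - t) = -G (t - s) := fun s t => by rw [← ho, neg_sub]
  have eg : ∀ s t, g (s - t) = g (t - s) := fun s t => by rw [← he, neg_sub]
  have cφ : ∀ x, ∫ t, φ t * g (t - x) = conv g φ x := fun x => by
    rw [conv]; congr 1; ext t; rw [eg]; ring
  have i1 := hint h1 (C := fun p => G (y - p.2)) (by fun_prop)
  have i2 := hint h1 (C := fun p => G (p.2 - p.1)) (by fun_prop)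
  have i3 := hint h2 (C := fun p => G (p.2 - p.1)) (by fun_prop)
  have i4 := hint h2 (C := fun p => G (p.1 - y)) (by fun_prop)
  have i5 := hint h3 (C := fun p => G (p.1 - y)) (by fun_prop)
  have i6 := hint h3 (C := fun p => G (y - p.2)) (by fun_prop)
  have e1 : ∫ p : ℝ × ℝ, φ p.1 * χ p.2 * (g (p.1 - y) * G (y - p.2))
      = conv g φ y * conv G χ y := by
    rw [conv, conv, ← integral_prod_mul, ← Measure.volume_eq_prod]
    congr 1; ext p; rw [eg]; ring
  have e4 : ∫ p : ℝ × ℝ, φ p.1 * χ p.2 * (g (y - p.2) * G (p.1 - y))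
      = -(conv G φ y * conv g χ y) := by
    rw [conv, conv, ← integral_prod_mul, ← Measure.volume_eq_prod, ← integral_neg]
    congr 1; ext p; rw [oG]; ring
  have e2 : ∫ p : ℝ × ℝ, φ p.1 * χ p.2 * (g (p.1 - y) * G (p.2 - p.1))
      = -conv g (fun x => φ x * conv G χ x) y := by
    rw [Measure.volume_eq_prod, integral_prod _ i2, conv, ← integral_neg]
    congr 1; ext x
    rw [conv, ← integral_const_mul, ← integral_const_mul, ← integral_neg]
    congr 1; ext z
    simp only
    rw [eg, oG]; ring
  have e3 : ∫ p : ℝ × ℝ, φ p.1 * χ p.2 * (g (y - p.2) * G (p.2 - p.1))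
      = conv g (fun x => χ x * conv G φ x) y := by
    rw [Measure.volume_eq_prod, integral_prod_symm _ i3, conv]
    congr 1; ext z
    rw [conv, ← integral_const_mul, ← integral_const_mul]
    congr 1; ext x
    ring
  have e5 : ∫ p : ℝ × ℝ, φ p.1 * χ p.2 * (g (p.2 - p.1) * G (p.1 - y))
      = -conv G (fun x => φ x * conv g χ x) y := by
    rw [Measure.volume_eq_prod, integral_prod _ i5, conv, ← integral_neg]
    congr 1; ext x
    rw [conv, ← integral_const_mul, ← integral_const_mul, ← integral_neg]
    congr 1; ext z
    simp only
    rw [eg, oG]; ring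
  have e6 : ∫ p : ℝ × ℝ, φ p.1 * χ p.2 * (g (p.2 - p.1) * G (y - p.2))
      = conv G (fun x => χ x * conv g φ x) y := by
    rw [Measure.volume_eq_prod, integral_prod_symm _ i6, conv]
    congr 1; ext z
    rw [conv, ← integral_const_mul, ← integral_const_mul]
    congr 1; ext x
    ring
  have hsum : ∫ p : ℝ × ℝ, φ p.1 * χ p.2 * threeTerm G g (p.1 - y) (y - p.2) (p.2 - p.1)
      = (∫ p : ℝ × ℝ, φ p.1 * χ p.2 * (g (p.1 - y) * G (y - p.2)))
        + (∫ p : ℝ × ℝ, φ p.1 * χ p.2 * (g (p.1 - y) * G (p.2 - p.1)))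
        + (∫ p : ℝ × ℝ, φ p.1 * χ p.2 * (g (y - p.2) * G (p.2 - p.1)))
        + (∫ p : ℝ × ℝ, φ p.1 * χ p.2 * (g (y - p.2) * G (p.1 - y)))
        + (∫ p : ℝ × ℝ, φ p.1 * χ p.2 * (g (p.2 - p.1) * G (p.1 - y)))
        + ∫ p : ℝ × ℝ, φ p.1 * χ p.2 * (g (p.2 - p.1) * G (y - p.2)) := by
    rw [← integral_add i1 i2, ← integral_add (i1.fun_add i2) i3,
      ← integral_add ((i1.fun_add i2).fun_add i3) i4,
      ← integral_add (((i1.fun_add i2).fun_add i3).fun_add i4) i5,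
      ← integral_add ((((i1.fun_add i2).fun_add i3).fun_add i4).fun_add i5) i6]
    congr 1; ext p
    rw [threeTerm]; ring
  rw [hsum, e1, e2, e3, e4, e5, e6, triDensity]
  ring

theorem isTest_exp_mul {φ : ℝ → ℝ} (hφ : IsTest φ) (l : ℝ) :
    IsTest (fun x => Real.exp (-(l * x)) * φ x) :=
  hφ.mul_left (contDiff_const.mul contDiff_id).neg.exp

/-- On a state that agrees with `exp (l x)` near the support of `φ`, the test function
`exp (-l x) φ` has momentum `b φ' - l φ`. -/
theorem mom_exp (b l : ℝ) {m φ : ℝ → ℝ} (hφ : IsTest φ)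
    (hm : ∀ x ∈ tsupport φ, m =ᶠ[𝓝 x] fun y => Real.exp (l * y)) :
    mom b m (fun x => Real.exp (-(l * x)) * φ x) = fun x => b * deriv φ x - l * φ x := by
  ext x
  have hd : deriv (fun x => Real.exp (-(l * x)) * φ x) x
      = Real.exp (-(l * x)) * (deriv φ x - l * φ x) := by
    have h1 : HasDerivAt (fun x : ℝ => Real.exp (-(l * x))) (Real.exp (-(l * x)) * -(l * 1)) x :=
      ((hasDerivAt_id x).const_mul l).fun_neg.exp
    rw [(h1.fun_mul (hφ.differentiable x).hasDerivAt).deriv]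
    ring
  rw [mom, hd]
  by_cases hx : x ∈ tsupport φ
  · have h2 : HasDerivAt (fun x : ℝ => Real.exp (l * x)) (Real.exp (l * x) * (l * 1)) x :=
      ((hasDerivAt_id x).const_mul l).exp
    rw [(hm x hx).deriv_eq, (hm x hx).eq_of_nhds, h2.deriv]
    have h3 : Real.exp (l * x) * Real.exp (-(l * x)) = 1 := by rw [← Real.exp_add]; simp
    linear_combination (b * (deriv φ x - l * φ x) + (b - 1) * l * φ x) * h3
  · have h4 : φ x = 0 := image_eq_zero_of_notMem_tsupport hx
    have h5 : deriv φ x = 0 :=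
      image_eq_zero_of_notMem_tsupport fun h => hx (tsupport_deriv_subset h)
    simp [h4, h5]

theorem exists_schwartz_eq_exp (l R : ℝ) : ∃ m : 𝓢(ℝ, ℝ), ∀ x ∈ Metric.ball (0 : ℝ) R,
    m =ᶠ[𝓝 x] fun y => Real.exp (l * y) := by
  obtain hR | hR := le_or_gt R 0
  · exact ⟨0, by simp [Metric.ball_eq_empty.2 hR]⟩
  let c : ContDiffBump (0 : ℝ) := ⟨R, R + 1, hR, by linarith⟩
  have ht : IsTest (fun x => c x * Real.exp (l * x)) :=
    IsTest.mul_right ⟨c.contDiff, c.hasCompactSupport⟩ (contDiff_const.mul contDiff_id).exp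
  refine ⟨ht.2.toSchwartzMap ht.1, fun x hx => ?_⟩
  filter_upwards [Metric.isOpen_ball.mem_nhds hx] with y hy
  have : c y = 1 := c.one_of_mem_closedBall (Metric.ball_subset_closedBall hy)
  simp [this]

theorem triForm_sub_mul {g φ ψ η χ : ℝ → ℝ} (he : Function.Even g) (hg : LocallyIntegrable g)
    (hφ : IsTest φ) (hψ : IsTest ψ) (hη : IsTest η) (hχ : IsTest χ) (l : ℝ) :
    triForm (antideriv g) φ (fun x => ψ x - l * η x) χ
      = triForm (antideriv g) φ ψ χ - l * triForm (antideriv g) φ η χ := by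
  have hc := continuous_triDensity (continuous_antideriv hg).locallyIntegrable hg hφ hχ
  have i : ∀ {f : ℝ → ℝ}, IsTest f →
      Integrable (fun y => f y * triDensity (antideriv g) g φ χ y) := fun hf =>
    (hf.continuous.mul hc).integrable_of_hasCompactSupport hf.2.mul_right
  rw [triForm_eq_integral he hg hφ (hψ.sub (hη.const_mul l)) hχ, triForm_eq_integral he hg hφ hψ hχ,
    triForm_eq_integral he hg hφ hη hχ, ← integral_const_mul,
    ← integral_sub (i hψ) ((i hη).const_mul l)]
  congr 1; ext y; ring

/-- If the Jacobi identity holds at states equal to `exp (l x)` on large intervals, the trilinear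
form vanishes: it is, up to sign, the top coefficient of the Jacobiator, which is a cubic polynomial
in `l`. -/
theorem triForm_eq_zero_of_jacobi {g φ ψ χ : ℝ → ℝ} {b : ℝ} (he : Function.Even g)
    (hg : LocallyIntegrable g) (hJ : JacobiIdentity (antideriv g) b)
    (hφ : IsTest φ) (hψ : IsTest ψ) (hχ : IsTest χ) : triForm (antideriv g) φ ψ χ = 0 := by
  have hG := (continuous_antideriv hg).locallyIntegrable (μ := volume)
  obtain ⟨R, hR⟩ := ((hφ.2.isCompact.union hψ.2.isCompact).union
    hχ.2.isCompact).isBounded.subset_ball (0 : ℝ)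
  have h0 : ∀ l : ℝ, triForm (antideriv g) (fun x => b * deriv φ x - l * φ x)
      (fun x => b * deriv ψ x - l * ψ x) (fun x => b * deriv χ x - l * χ x) = 0 := fun l => by
    obtain ⟨m, hm⟩ := exists_schwartz_eq_exp l R
    have h := jacobiator_eq_neg_triForm b hG (antideriv_odd he) (isTest_exp_mul hφ l)
      (isTest_exp_mul hψ l) (isTest_exp_mul hχ l) m
    rw [hJ _ _ _ (isTest_exp_mul hφ l) (isTest_exp_mul hψ l) (isTest_exp_mul hχ l) m,
      mom_exp b l hφ fun x hx => hm x (hR (Or.inl (Or.inl hx))),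
      mom_exp b l hψ fun x hx => hm x (hR (Or.inl (Or.inr hx))),
      mom_exp b l hχ fun x hx => hm x (hR (Or.inr hx))] at h
    linarith
  have dφ := hφ.deriv.const_mul b
  have dψ := hψ.deriv.const_mul b
  have dχ := hχ.deriv.const_mul b
  have s1 : ∀ (l : ℝ) {f h : ℝ → ℝ}, IsTest f → IsTest h →
      triForm (antideriv g) (fun x => b * deriv φ x - l * φ x) f h
        = triForm (antideriv g) (fun x => b * deriv φ x) f h
          - l * triForm (antideriv g) φ f h := fun l f h hf hh => by
    rw [← triForm_cycle, triForm_sub_mul he hg hh dφ hφ hf, triForm_cycle, triForm_cycle _ h φ]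
  have s3 : ∀ (l : ℝ) {f h : ℝ → ℝ}, IsTest f → IsTest h →
      triForm (antideriv g) f h (fun x => b * deriv χ x - l * χ x)
        = triForm (antideriv g) f h (fun x => b * deriv χ x)
          - l * triForm (antideriv g) f h χ := fun l f h hf hh => by
    rw [triForm_cycle, triForm_sub_mul he hg hh dχ hχ hf, ← triForm_cycle, ← triForm_cycle _ f h χ]
  have s2 := fun (l : ℝ) {f h : ℝ → ℝ} (hf : IsTest f) (hh : IsTest h) =>
    triForm_sub_mul he hg hf dψ hψ hh l
  have h1 : ∀ l : ℝ, _ := fun l => by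
    have := h0 l
    rw [s1 l (dψ.sub (hψ.const_mul l)) (dχ.sub (hχ.const_mul l)),
      s2 l dφ (dχ.sub (hχ.const_mul l)), s2 l hφ (dχ.sub (hχ.const_mul l)),
      s3 l dφ dψ, s3 l dφ hψ, s3 l hφ dψ, s3 l hφ hψ] at this
    exact this
  -- the third difference extracts the coefficient of `l ^ 3`
  linear_combination (1 / 6) * h1 1 - (1 / 6) * h1 (-1) - (1 / 12) * h1 2 + (1 / 12) * h1 (-2)

theorem fe1_eq_threeTerm (G : ℝ → ℝ) (α β γ : ℝ) : fe1 G α β γ = threeTerm G (deriv G) α β γ := rfl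

/-- In the functional equation the derivative of `G` may be replaced by `g` almost everywhere. -/
theorem functionalEqAE_iff {g : ℝ → ℝ} (hg : LocallyIntegrable g) :
    FunctionalEqAE (antideriv g) ↔
      ∀ᵐ p : ℝ × ℝ, threeTerm (antideriv g) g p.1 p.2 (-p.1 - p.2) = 0 := by
  have h := ae_deriv_antideriv hg
  have q1 : ∀ᵐ p : ℝ × ℝ, deriv (antideriv g) p.1 = g p.1 :=
    Measure.quasiMeasurePreserving_fst.ae h
  have q2 : ∀ᵐ p : ℝ × ℝ, deriv (antideriv g) p.2 = g p.2 :=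
    Measure.quasiMeasurePreserving_snd.ae h
  have q3 : ∀ᵐ p : ℝ × ℝ, deriv (antideriv g) (-p.1 - p.2) = g (-p.1 - p.2) := by
    have h' : ∀ᵐ x, deriv (antideriv g) (-x) = g (-x) :=
      (Measure.measurePreserving_neg (volume : Measure ℝ)).quasiMeasurePreserving.ae h
    have := (quasiMeasurePreserving_add (volume : Measure ℝ) (volume : Measure ℝ)).ae h'
    filter_upwards [this] with p hp
    rwa [neg_add'] at hp
  refine eventually_congr ?_
  filter_upwards [q1, q2, q3] with p h1 h2 h3
  rw [fe1_eq_threeTerm, threeTerm, threeTerm, h1, h2, h3]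

theorem jacobi_iff_functionalEqAE {g : ℝ → ℝ} (b : ℝ) (he : Function.Even g)
    (hg : LocallyIntegrable g) :
    JacobiIdentity (antideriv g) b ↔ FunctionalEqAE (antideriv g) := by
  have hGc := continuous_antideriv hg
  have hG := hGc.locallyIntegrable (μ := volume)
  have ho := antideriv_odd he
  rw [functionalEqAE_iff hg]
  constructor
  · intro hJ
    have hW : ∀ φ χ, IsTest φ → IsTest χ → triDensity (antideriv g) g φ χ = 0 := by
      intro φ χ hφ hχ
      have hc := continuous_triDensity hG hg hφ hχ
      refine (Continuous.ae_eq_iff_eq (volume : Measure ℝ) hc continuous_zero).1 ?_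
      refine ae_eq_zero_of_integral_contDiff_smul_eq_zero hc.locallyIntegrable fun ψ hψ hψc => ?_
      have := triForm_eq_zero_of_jacobi he hg hJ hφ ⟨hψ, hψc⟩ hχ
      rwa [triForm_eq_integral he hg hφ ⟨hψ, hψc⟩ hχ] at this
    have h0 := ae_eq_zero_of_integral_prod_isTest
      (locallyIntegrable_threeTerm hGc he hg 0).2.2.2 fun φ χ hφ hχ => by
        rw [integral_threeTerm_eq_triDensity hGc ho he hg hφ hχ, hW φ χ hφ hχ]; rfl
    have hmp : MeasurePreserving (fun p : ℝ × ℝ => (p.1, -p.2)) volume volume :=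
      (MeasurePreserving.id (volume : Measure ℝ)).prod
        (Measure.measurePreserving_neg (volume : Measure ℝ))
    filter_upwards [hmp.quasiMeasurePreserving.ae h0] with p hp
    simp only [sub_zero, zero_sub, neg_neg] at hp
    rwa [show -p.1 - p.2 = -p.2 - p.1 by ring]
  · intro h φ ψ χ hφ hψ hχ m
    rw [jacobiator_eq_neg_triForm b hG ho hφ hψ hχ, triForm_eq_integral he hg
      (isTest_mom b (m.smooth ⊤) hφ) (isTest_mom b (m.smooth ⊤) hψ)
      (isTest_mom b (m.smooth ⊤) hχ), neg_eq_zero]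
    refine integral_eq_zero_of_ae (ae_of_all _ fun y => ?_)
    simp only [Pi.zero_apply]
    rw [← integral_threeTerm_eq_triDensity hGc ho he hg (isTest_mom b (m.smooth ⊤) hφ)
      (isTest_mom b (m.smooth ⊤) hχ)]
    have hmp : MeasurePreserving (fun p : ℝ × ℝ => (p.1 - y, y - p.2)) volume volume :=
      (measurePreserving_sub_right (volume : Measure ℝ) y).prod
        (Measure.measurePreserving_sub_left (volume : Measure ℝ) y)
    have : ∀ᵐ p : ℝ × ℝ,
        threeTerm (antideriv g) g (p.1 - y) (y - p.2) (p.2 - p.1) = 0 := by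
      filter_upwards [hmp.quasiMeasurePreserving.ae h] with p hp
      rwa [show -(p.1 - y) - (y - p.2) = p.2 - p.1 by ring] at hp
    rw [integral_eq_zero_of_ae]
    · simp
    · filter_upwards [this] with p hp
      simp [hp]

theorem functionalEq_of_ae_of_continuous {g : ℝ → ℝ} (hg : Continuous g) :
    FunctionalEqAE (antideriv g) ↔ FunctionalEq (antideriv g) := by
  have hd : deriv (antideriv g) = g := funext fun x =>
    (intervalIntegral.integral_hasDerivAt_right (hg.intervalIntegrable _ _)
      (hg.stronglyMeasurableAtFilter _ _) hg.continuousAt).deriv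
  have hG := continuous_antideriv hg.locallyIntegrable
  constructor
  · intro h α β γ hs
    have hc : Continuous (fun p : ℝ × ℝ => fe1 (antideriv g) p.1 p.2 (-p.1 - p.2)) := by
      simp only [fe1, hd]; fun_prop
    have := (Continuous.ae_eq_iff_eq (volume : Measure (ℝ × ℝ)) hc continuous_zero).1 h
    rw [show γ = -α - β by linarith]
    exact congrFun this (α, β)
  · intro h
    exact ae_of_all _ fun p => h _ _ _ (by ring)

open Filter Topology

/-! ### Differential consequences of the functional equation -/

theorem contDiffAt_iteratedDeriv {G : ℝ → ℝ} {x : ℝ} (k j : ℕ)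
    (h : ContDiffAt ℝ (k + j : ℕ) G x) : ContDiffAt ℝ j (iteratedDeriv k G) x := by
  induction k generalizing j with
  | zero => simpa using h
  | succ k ih =>
    rw [iteratedDeriv_succ]
    have := ih (j + 1) (by rwa [show k + (j + 1) = k + 1 + j by ring])
    exact this.derivWithin (by norm_cast)

theorem hasDerivAt_iteratedDeriv_of_contDiffAt {G : ℝ → ℝ} {x : ℝ} {n : ℕ} (k : ℕ)
    (h : ContDiffAt ℝ n G x) (hk : k < n) :
    HasDerivAt (iteratedDeriv k G) (iteratedDeriv (k + 1) G x) x := by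
  rw [iteratedDeriv_succ]
  have h' : ContDiffAt ℝ (k + 1 : ℕ) G x := h.of_le (by exact_mod_cast hk)
  exact ((contDiffAt_iteratedDeriv k 1 h').differentiableAt (by simp)).hasDerivAt

theorem continuousAt_iteratedDeriv_of_contDiffAt {G : ℝ → ℝ} {x : ℝ} {n : ℕ} (k : ℕ)
    (h : ContDiffAt ℝ n G x) (hk : k ≤ n) : ContinuousAt (iteratedDeriv k G) x := by
  have h' : ContDiffAt ℝ (k + 0 : ℕ) G x := h.of_le (by exact_mod_cast hk)
  exact (contDiffAt_iteratedDeriv k 0 h').continuousAt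

/-- The points of the plane `α + β + γ = 0`, in the coordinates `(α, β)`, at which `G` is `n` times
continuously differentiable near all three of `α`, `β`, `γ`. -/
def SmoothAt (G : ℝ → ℝ) (n : ℕ) (p : ℝ × ℝ) : Prop :=
  ContDiffAt ℝ n G p.1 ∧ ContDiffAt ℝ n G p.2 ∧ ContDiffAt ℝ n G (-p.1 - p.2)

theorem SmoothAt.eventually {G : ℝ → ℝ} {n : ℕ} {p : ℝ × ℝ} (h : SmoothAt G n p) :
    ∀ᶠ q in 𝓝 p, SmoothAt G n q := by
  have c3 : ContinuousAt (fun p : ℝ × ℝ => -p.1 - p.2) p := by fun_prop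
  exact (continuousAt_fst.eventually (h.1.eventually (by simp))).and
    ((continuousAt_snd.eventually (h.2.1.eventually (by simp))).and
      (c3.eventually (h.2.2.eventually (by simp))))

/-- Where `G` is continuously differentiable, the functional equation is continuous, so it holds
pointwise if it holds almost everywhere. -/
theorem fe1_eq_zero_of_functionalEqAE {G : ℝ → ℝ} (h : FunctionalEqAE G) {p : ℝ × ℝ}
    (hp : SmoothAt G 1 p) : fe1 G p.1 p.2 (-p.1 - p.2) = 0 := by
  have c3 : ContinuousAt (fun p : ℝ × ℝ => -p.1 - p.2) p := by fun_prop
  have cG : ∀ {x}, ContDiffAt ℝ (1 : ℕ) G x → ContinuousAt (deriv G) x := fun hx => by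
    simpa using continuousAt_iteratedDeriv_of_contDiffAt 1 hx le_rfl
  have d1 : ContinuousAt (fun p : ℝ × ℝ => deriv G p.1) p :=
    (cG hp.1).comp' continuousAt_fst
  have d2 : ContinuousAt (fun p : ℝ × ℝ => deriv G p.2) p :=
    (cG hp.2.1).comp' continuousAt_snd
  have d3 : ContinuousAt (fun p : ℝ × ℝ => deriv G (-p.1 - p.2)) p :=
    ContinuousAt.comp' (f := fun p : ℝ × ℝ => -p.1 - p.2) (cG hp.2.2) c3
  have g1 : ContinuousAt (fun p : ℝ × ℝ => G p.1) p :=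
    hp.1.continuousAt.comp' continuousAt_fst
  have g2 : ContinuousAt (fun p : ℝ × ℝ => G p.2) p :=
    hp.2.1.continuousAt.comp' continuousAt_snd
  have g3 : ContinuousAt (fun p : ℝ × ℝ => G (-p.1 - p.2)) p :=
    ContinuousAt.comp' (f := fun p : ℝ × ℝ => -p.1 - p.2) hp.2.2.continuousAt c3
  have hc : ContinuousAt (fun p : ℝ × ℝ => fe1 G p.1 p.2 (-p.1 - p.2)) p :=
    ((d1.mul (g2.add g3)).add (d2.mul (g3.add g1))).add (d3.mul (g1.add g2))
  by_contra hne
  have hfr := mem_closure_iff_frequently.1 (Measure.dense_of_ae h p)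
  exact hfr ((hc.eventually_ne hne).mono fun q hq hq' => hq hq')

theorem hasDerivAt_comp_add {f : ℝ → ℝ} {f' x : ℝ} (h : HasDerivAt f f' x) :
    HasDerivAt (fun s => f (x + s)) f' 0 := by
  have h' : HasDerivAt f f' (x + 0) := by simpa using h
  simpa [Function.comp_def] using h'.comp 0 ((hasDerivAt_id (0 : ℝ)).const_add x)

theorem hasDerivAt_comp_sub {f : ℝ → ℝ} {f' x : ℝ} (h : HasDerivAt f f' x) :
    HasDerivAt (fun s => f (x - s)) (-f') 0 := by
  have h' : HasDerivAt f f' (x - 0) := by simpa using h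
  simpa [Function.comp_def] using h'.comp 0 ((hasDerivAt_id (0 : ℝ)).const_sub x)

theorem eq_zero_of_hasDerivAt_of_eventually {f : ℝ → ℝ} {f' : ℝ} (h : HasDerivAt f f' 0)
    (h0 : ∀ᶠ s in 𝓝 0, f s = 0) : f' = 0 :=
  h.unique ((hasDerivAt_const 0 (0 : ℝ)).congr_of_eventuallyEq h0)

/-- The derivative of `fe1 = 0` along `∂_α - ∂_γ`. -/
theorem fe2_eq_zero {G : ℝ → ℝ} (h : FunctionalEqAE G) {α β γ : ℝ} (hs : α + β + γ = 0)
    (hα : ContDiffAt ℝ (2 : ℕ) G α) (hβ : ContDiffAt ℝ (2 : ℕ) G β)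
    (hγ : ContDiffAt ℝ (2 : ℕ) G γ) : fe2 G α β γ = 0 := by
  have hsm : SmoothAt G 2 (α, β) := ⟨hα, hβ, by rwa [show -α - β = γ by linarith]⟩
  have hc : ContinuousAt (fun s : ℝ => (α + s, β)) 0 := by fun_prop
  have hev : ∀ᶠ s : ℝ in 𝓝 0, fe1 G (α + s) β (γ - s) = 0 := by
    have h0 : ∀ᶠ q in 𝓝 ((fun s : ℝ => (α + s, β)) 0), SmoothAt G 2 q := by
      simpa using hsm.eventually
    filter_upwards [hc.eventually h0] with s hq
    have h1 : SmoothAt G 1 (α + s, β) :=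
      ⟨hq.1.of_le (by norm_num), hq.2.1.of_le (by norm_num), hq.2.2.of_le (by norm_num)⟩
    have := fe1_eq_zero_of_functionalEqAE h h1
    rwa [show -(α + s, β).1 - (α + s, β).2 = γ - s by simp only; linarith] at this
  have a0 := hasDerivAt_comp_add (hα.differentiableAt (by simp)).hasDerivAt
  have c0 := hasDerivAt_comp_sub (hγ.differentiableAt (by simp)).hasDerivAt
  have a1 := hasDerivAt_comp_add (hasDerivAt_iteratedDeriv_of_contDiffAt 1 hα (by norm_num))
  have c1 := hasDerivAt_comp_sub (hasDerivAt_iteratedDeriv_of_contDiffAt 1 hγ (by norm_num))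
  simp only [iteratedDeriv_one] at a1 c1
  have key := ((a1.fun_mul (c0.const_add (G β))).fun_add
    ((c0.fun_add a0).const_mul (deriv G β))).fun_add (c1.fun_mul (a0.add_const (G β)))
  have := eq_zero_of_hasDerivAt_of_eventually key hev
  simp only [add_zero, sub_zero, one_add_one_eq_two] at this
  rw [fe2]
  linear_combination this

/-- The derivative of the second-order equation along `∂_β - ∂_γ`. -/
theorem fe3_eq_zero {G : ℝ → ℝ} (h : FunctionalEqAE G) {α β γ : ℝ} (hs : α + β + γ = 0)
    (hα : ContDiffAt ℝ (3 : ℕ) G α) (hβ : ContDiffAt ℝ (3 : ℕ) G β)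
    (hγ : ContDiffAt ℝ (3 : ℕ) G γ) : fe3 G α β γ = 0 := by
  have hsm : SmoothAt G 3 (α, β) := ⟨hα, hβ, by rwa [show -α - β = γ by linarith]⟩
  have hc : ContinuousAt (fun s : ℝ => (α, β + s)) 0 := by fun_prop
  have hev : ∀ᶠ s : ℝ in 𝓝 0, fe2 G (β + s) (γ - s) α = 0 := by
    have h0 : ∀ᶠ q in 𝓝 ((fun s : ℝ => (α, β + s)) 0), SmoothAt G 3 q := by
      simpa using hsm.eventually
    filter_upwards [hc.eventually h0] with s hq
    have h3 := hq.2.2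
    rw [show -(α, β + s).1 - (α, β + s).2 = γ - s by simp only; linarith] at h3
    exact fe2_eq_zero h (by linarith) (hq.2.1.of_le (by norm_num)) (h3.of_le (by norm_num))
      (hq.1.of_le (by norm_num))
  have b0 := hasDerivAt_comp_add (hβ.differentiableAt (by simp)).hasDerivAt
  have c0 := hasDerivAt_comp_sub (hγ.differentiableAt (by simp)).hasDerivAt
  have b1 := hasDerivAt_comp_add (hasDerivAt_iteratedDeriv_of_contDiffAt 1 hβ (by norm_num))
  have c1 := hasDerivAt_comp_sub (hasDerivAt_iteratedDeriv_of_contDiffAt 1 hγ (by norm_num))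
  have b2 := hasDerivAt_comp_add (hasDerivAt_iteratedDeriv_of_contDiffAt 2 hβ (by norm_num))
  simp only [iteratedDeriv_one] at b1 c1
  have key := ((c1.fun_mul (b1.sub_const (deriv G α))).fun_sub
    ((b0.fun_add c0).const_mul (iteratedDeriv 2 G α))).fun_add (b2.fun_mul (c0.add_const (G α)))
  have := eq_zero_of_hasDerivAt_of_eventually key hev
  simp only [add_zero, sub_zero, one_add_one_eq_two, show 2 + 1 = 3 from rfl] at this
  rw [fe3]
  linear_combination this

/-- If `G` is locally constant at two of the three points, the third-order equation is trivial. -/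
theorem fe4_eq_zero_of_eventually_add_eq_zero {G : ℝ → ℝ} {β γ : ℝ} (α : ℝ)
    (h : ∀ᶠ q : ℝ × ℝ in 𝓝 (β, γ), G q.1 + G q.2 = 0) : fe4 G α β γ = 0 := by
  have c1 : ContinuousAt (fun x : ℝ => (x, γ)) β := by fun_prop
  have c2 : ContinuousAt (fun x : ℝ => (β, x)) γ := by fun_prop
  have e1 : G =ᶠ[𝓝 β] fun _ => -G γ := (c1.eventually h).mono fun x hx => by
    simp only at hx ⊢; linarith
  have e2 : G =ᶠ[𝓝 γ] fun _ => -G β := (c2.eventually h).mono fun x hx => by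
    simp only at hx ⊢; linarith
  have b1 := e1.iteratedDeriv_eq 1
  have b3 := e1.iteratedDeriv_eq 3
  have c1' := e2.iteratedDeriv_eq 1
  have c3 := e2.iteratedDeriv_eq 3
  simp only [iteratedDeriv_const, iteratedDeriv_one] at b1 b3 c1' c3
  simp at b1 b3 c1' c3
  simp [fe4, b1, b3, c1', c3]

theorem fe4_cycle (G : ℝ → ℝ) (α β γ : ℝ) : fe4 G α β γ = fe4 G β γ α := by
  simp only [fe4]; ring

/-- The third-order equation, multiplied by the three pairwise sums of `G`, is an algebraic
consequence of the lower-order ones. -/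
theorem mul_fe4_eq_zero {G : ℝ → ℝ} (h : FunctionalEqAE G) {p : ℝ × ℝ} (hp : SmoothAt G 3 p) :
    (G p.2 + G (-p.1 - p.2)) * (G (-p.1 - p.2) + G p.1) * (G p.1 + G p.2)
      * fe4 G p.1 p.2 (-p.1 - p.2) = 0 := by
  obtain ⟨α, β⟩ := p
  obtain ⟨hα, hβ, hγ⟩ := hp
  simp only at hα hβ hγ ⊢
  have hs : α + β + (-α - β) = 0 := by ring
  have f0 := fe1_eq_zero_of_functionalEqAE h (p := (α, β))
    ⟨hα.of_le (by norm_num), hβ.of_le (by norm_num), hγ.of_le (by norm_num)⟩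
  simp only at f0
  have l : ∀ {x}, ContDiffAt ℝ (3 : ℕ) G x → ContDiffAt ℝ (2 : ℕ) G x :=
    fun hx => hx.of_le (by norm_num)
  generalize -α - β = γ at *
  have s1 : β + γ + α = 0 := by linarith
  have s2 : γ + α + β = 0 := by linarith
  have fβ := fe2_eq_zero h hs (l hα) (l hβ) (l hγ)
  have fγ := fe2_eq_zero h s1 (l hβ) (l hγ) (l hα)
  have fα := fe2_eq_zero h s2 (l hγ) (l hα) (l hβ)
  have eβ := fe3_eq_zero h hs hα hβ hγ
  have eγ := fe3_eq_zero h s1 hβ hγ hα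
  have eα := fe3_eq_zero h s2 hγ hα hβ
  simp only [fe1, fe2, fe3, fe4] at *
  generalize iteratedDeriv 3 G α = a3 at *
  generalize iteratedDeriv 3 G β = b3 at *
  generalize iteratedDeriv 3 G γ = c3 at *
  generalize iteratedDeriv 2 G α = a2 at *
  generalize iteratedDeriv 2 G β = b2 at *
  generalize iteratedDeriv 2 G γ = c2 at *
  generalize deriv G α = a1 at *
  generalize deriv G β = b1 at *
  generalize deriv G γ = c1 at *
  generalize G α = a at *
  generalize G β = b at *
  generalize G γ = c at *
  -- eliminate the third derivatives first; what is left is the vector identity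
  -- `(v × (1,1,1)) × P = (v · P) (1,1,1) - (1,1,1) · P v` for the vectors `v` of first derivatives
  -- and `P` of pairwise sums
  linear_combination (b1 - c1) * (c + a) * (a + b) * eα + (c1 - a1) * (b + c) * (a + b) * eβ
    + (a1 - b1) * (b + c) * (c + a) * eγ
    + 2 * (a + b + c) * (a2 * (b + c) * fα + b2 * (c + a) * fβ + c2 * (a + b) * fγ)
    + (a2 * (b + c) * (b1 - c1) + b2 * (c + a) * (c1 - a1) + c2 * (a + b) * (a1 - b1)) * f0

theorem SmoothAt.continuousAt_fe4 {G : ℝ → ℝ} {p : ℝ × ℝ} (h : SmoothAt G 3 p) :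
    ContinuousAt (fun p : ℝ × ℝ => fe4 G p.1 p.2 (-p.1 - p.2)) p := by
  have k : ∀ {u : ℝ × ℝ → ℝ}, ContinuousAt u p → ContDiffAt ℝ (3 : ℕ) G (u p) →
      ContinuousAt (fun p => deriv G (u p)) p ∧
        ContinuousAt (fun p => iteratedDeriv 3 G (u p)) p := fun hu hc => by
    have h1 := continuousAt_iteratedDeriv_of_contDiffAt 1 hc (by norm_num)
    rw [iteratedDeriv_one] at h1
    exact ⟨h1.comp' hu, (continuousAt_iteratedDeriv_of_contDiffAt 3 hc le_rfl).comp' hu⟩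
  obtain ⟨a1, a3⟩ := k continuousAt_fst h.1
  obtain ⟨b1, b3⟩ := k continuousAt_snd h.2.1
  obtain ⟨c1, c3⟩ := k (u := fun p : ℝ × ℝ => -p.1 - p.2) (by fun_prop) h.2.2
  exact ((a3.mul (b1.sub c1)).add (b3.mul (c1.sub a1))).add (c3.mul (a1.sub b1))

/-- Near a point where the third-order expression does not vanish, each pairwise sum of values of
`G` is nonzero somewhere. -/
theorem frequently_add_ne_zero {G : ℝ → ℝ} {p : ℝ × ℝ} (hp : fe4 G p.1 p.2 (-p.1 - p.2) ≠ 0) :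
    (∃ᶠ q : ℝ × ℝ in 𝓝 p, G q.2 + G (-q.1 - q.2) ≠ 0) ∧
    (∃ᶠ q : ℝ × ℝ in 𝓝 p, G (-q.1 - q.2) + G q.1 ≠ 0) ∧
    (∃ᶠ q : ℝ × ℝ in 𝓝 p, G q.1 + G q.2 ≠ 0) := by
  simp only [Filter.Frequently, ne_eq, not_not]
  refine ⟨fun hev => hp ?_, fun hev => hp ?_, fun hev => hp ?_⟩
  · refine fe4_eq_zero_of_eventually_add_eq_zero p.1 ?_
    have hc : Continuous (fun q : ℝ × ℝ => (-q.1 - q.2, q.1)) := by fun_prop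
    have h2 := hc.tendsto (p.2, -p.1 - p.2)
    rw [show (-(p.2, -p.1 - p.2).1 - (p.2, -p.1 - p.2).2, (p.2, -p.1 - p.2).1) = p from
      Prod.ext (by simp only; ring) rfl] at h2
    filter_upwards [h2.eventually hev] with q hq
    rwa [show -(-q.1 - q.2) - q.1 = q.2 by ring] at hq
  · rw [fe4_cycle]
    refine fe4_eq_zero_of_eventually_add_eq_zero p.2 ?_
    have hc : Continuous (fun q : ℝ × ℝ => (q.2, -q.1 - q.2)) := by fun_prop
    have h2 := hc.tendsto (-p.1 - p.2, p.1)
    rw [show ((-p.1 - p.2, p.1).2, -(-p.1 - p.2, p.1).1 - (-p.1 - p.2, p.1).2) = p from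
      Prod.ext rfl (by simp only; ring)] at h2
    filter_upwards [h2.eventually hev] with q hq
    rwa [show -q.2 - (-q.1 - q.2) = q.1 by ring] at hq
  · rw [← fe4_cycle]
    exact fe4_eq_zero_of_eventually_add_eq_zero _ hev

theorem fe4_eq_zero {G : ℝ → ℝ} (hG : Continuous G) (h : FunctionalEqAE G) {α β γ : ℝ}
    (hs : α + β + γ = 0) (hα : ContDiffAt ℝ (3 : ℕ) G α) (hβ : ContDiffAt ℝ (3 : ℕ) G β)
    (hγ : ContDiffAt ℝ (3 : ℕ) G γ) : fe4 G α β γ = 0 := by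
  obtain rfl : γ = -α - β := by linarith
  have hsm : SmoothAt G 3 (α, β) := ⟨hα, hβ, hγ⟩
  by_contra hne
  have hE := hsm.eventually.and (hsm.continuousAt_fe4.eventually_ne hne)
  -- move to a nearby point where all three pairwise sums are nonzero
  obtain ⟨p1, h1, hE1⟩ :=
    ((frequently_add_ne_zero (p := (α, β)) hne).1.and_eventually hE.eventually_nhds).exists
  have c1 : Continuous fun q : ℝ × ℝ => G q.2 + G (-q.1 - q.2) := by fun_prop
  have k1 := c1.continuousAt.eventually_ne h1
  obtain ⟨p2, h2, hE2⟩ := ((frequently_add_ne_zero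
    hE1.self_of_nhds.2).2.1.and_eventually (hE1.and k1).eventually_nhds).exists
  have c2 : Continuous fun q : ℝ × ℝ => G (-q.1 - q.2) + G q.1 := by fun_prop
  have k2 := c2.continuousAt.eventually_ne h2
  obtain ⟨p3, h3, ⟨hE3, h1'⟩, h2'⟩ := ((frequently_add_ne_zero
    hE2.self_of_nhds.1.2).2.2.and_eventually (hE2.and k2)).exists
  exact mul_ne_zero (mul_ne_zero (mul_ne_zero h1' h2') h3) hE3.2 (mul_fe4_eq_zero h hE3.1)

open Filter Topology

/-! ### The Hamiltonian and its variational derivative -/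

theorem schwartz_decay (f : 𝓢(ℝ, ℝ)) (k : ℕ) : ∃ C, 0 ≤ C ∧ ∀ x, (1 + |x|) ^ k * |f x| ≤ C := by
  refine ⟨2 ^ k * (Finset.Iic (k, 0)).sup (fun m => SchwartzMap.seminorm ℝ m.1 m.2) f,
    by positivity, fun x => ?_⟩
  have := SchwartzMap.one_add_le_sup_seminorm_apply (𝕜 := ℝ) (m := (k, 0)) le_rfl le_rfl f x
  simpa using this

theorem integrable_inv_one_add_abs_sq : Integrable (fun x : ℝ => ((1 + |x|) ^ 2)⁻¹) := by
  refine integrable_inv_one_add_sq.mono' (by fun_prop) (ae_of_all _ fun x => ?_)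
  rw [Real.norm_of_nonneg (by positivity)]
  refine inv_anti₀ (by positivity) ?_
  nlinarith [abs_nonneg x, sq_abs x]

theorem integrable_one_add_abs_pow_mul (f : 𝓢(ℝ, ℝ)) (k : ℕ) :
    Integrable (fun x => (1 + |x|) ^ k * |f x|) := by
  obtain ⟨C, hC, h⟩ := schwartz_decay f (k + 2)
  have hf := f.continuous
  refine (integrable_inv_one_add_abs_sq.const_mul C).mono'
    (by fun_prop : Continuous _).aestronglyMeasurable (ae_of_all _ fun x => ?_)
  rw [Real.norm_of_nonneg (by positivity), ← div_eq_mul_inv, le_div_iff₀ (by positivity)]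
  calc (1 + |x|) ^ k * |f x| * (1 + |x|) ^ 2 = (1 + |x|) ^ (k + 2) * |f x| := by ring
    _ ≤ C := h x

theorem abs_mul_log_le {t : ℝ} (ht : 0 < t) : |t * Real.log t| ≤ t * t + 2 * √t := by
  have hs := Real.sqrt_pos.2 ht
  have h1 := Real.log_le_sub_one_of_pos ht
  have h2 := Real.log_le_sub_one_of_pos (inv_pos.2 hs)
  rw [Real.log_inv, Real.log_sqrt ht.le] at h2
  have h3 : t * (√t)⁻¹ = √t := by
    rw [← div_eq_mul_inv, Real.div_sqrt]
  rw [abs_le]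
  constructor <;> nlinarith

/-- The entropy of a positive state is finite. -/
theorem integrable_mul_log (m : 𝓢(ℝ, ℝ)) (hm : ∀ x, 0 < m x) :
    Integrable (fun x => m x * Real.log (m x)) := by
  obtain ⟨C, hC, h⟩ := schwartz_decay m 4
  obtain ⟨D, hD, h'⟩ := schwartz_decay m 1
  have hc : Continuous (fun x => m x * Real.log (m x)) :=
    Real.continuous_mul_log.comp m.continuous
  have i1 : Integrable (fun x => D * |m x|) := by
    simpa using (integrable_one_add_abs_pow_mul m 0).const_mul D
  refine (i1.fun_add (integrable_inv_one_add_abs_sq.const_mul (2 * √C))).mono'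
    hc.aestronglyMeasurable (ae_of_all _ fun x => (abs_mul_log_le (hm x)).trans ?_)
  have e1 : m x * m x ≤ D * |m x| := by
    rw [abs_of_pos (hm x)]
    have := h' x
    rw [abs_of_pos (hm x), pow_one] at this
    nlinarith [hm x, abs_nonneg x, mul_nonneg (abs_nonneg x) (hm x).le]
  have e2 : √(m x) ≤ √C * ((1 + |x|) ^ 2)⁻¹ := by
    rw [← div_eq_mul_inv, le_div_iff₀ (by positivity)]
    refine Real.le_sqrt_of_sq_le ?_
    rw [mul_pow, Real.sq_sqrt (hm x).le]
    have := h x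
    rw [abs_of_pos (hm x)] at this
    calc m x * ((1 + |x|) ^ 2) ^ 2 = (1 + |x|) ^ 4 * m x := by ring
      _ ≤ C := this
  linarith

theorem hasVarDeriv_hamiltonian_of_ne_one {b : ℝ} (hb : b ≠ 1) (m : 𝓢(ℝ, ℝ)) :
    HasVarDeriv (hamiltonian b) m (fun _ => 1 / (b - 1)) := by
  refine ⟨contDiff_const, fun v _ => ?_⟩
  have h : (fun ε : ℝ => hamiltonian b (m + ε • v))
      = fun ε => 1 / (b - 1) * (∫ x, m x) + ε * ∫ x, 1 / (b - 1) * v x := by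
    ext ε
    have hs : ∫ x, (m + ε • v) x = (∫ x, m x) + ε * ∫ x, v x := by
      rw [← integral_const_mul, ← integral_add m.integrable (v.integrable.const_mul _)]
      simp
    rw [hamiltonian, if_neg hb, hs, integral_const_mul]
    ring
  rw [h]
  simpa using ((hasDerivAt_id (0 : ℝ)).mul_const (∫ x, 1 / (b - 1) * v x)).const_add
    (1 / (b - 1) * ∫ x, m x)

theorem hasVarDeriv_hamiltonian_one (m : 𝓢(ℝ, ℝ)) (hm : ∀ x, 0 < m x) :
    HasVarDeriv (hamiltonian 1) m (fun x => Real.log (m x) + 1) := by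
  have hms : ContDiff ℝ ∞ m := m.smooth ⊤
  refine ⟨(hms.log fun x => (hm x).ne').add contDiff_const, fun v hv => ?_⟩
  -- a positive lower bound for `m` and bounds for `m`, `v` on the support of `v`
  obtain ⟨c, hc, hcm⟩ : ∃ c > 0, ∀ x ∈ tsupport v, c ≤ m x := by
    obtain hK | hK := (tsupport v).eq_empty_or_nonempty
    · exact ⟨1, one_pos, by simp [hK]⟩
    · obtain ⟨x₀, -, h₀⟩ := hv.isCompact.exists_isMinOn hK m.continuous.continuousOn
      exact ⟨m x₀, hm x₀, fun x hx => h₀ hx⟩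
  obtain ⟨D, hD, hDm⟩ := schwartz_decay m 0
  obtain ⟨C, hC, hCv⟩ := schwartz_decay v 0
  simp only [pow_zero, one_mul] at hDm hCv
  set δ := c / (2 * (C + 1)) with hδ
  have hδ0 : 0 < δ := by positivity
  have hεv : ∀ ε ∈ Metric.ball (0 : ℝ) δ, ∀ x, |ε * v x| ≤ c / 2 := fun ε hε x => by
    rw [mem_ball_zero_iff, Real.norm_eq_abs] at hε
    rw [abs_mul]
    calc |ε| * |v x| ≤ δ * (C + 1) := by
          gcongr
          linarith [hCv x]
      _ = c / 2 := by rw [hδ]; field_simp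
  have hlow : ∀ ε ∈ Metric.ball (0 : ℝ) δ, ∀ x ∈ tsupport v, c / 2 ≤ m x + ε * v x :=
    fun ε hε x hx => by
      have h1 := abs_le.1 (hεv ε hε x)
      linarith [hcm x hx, h1.1]
  have hpos : ∀ ε ∈ Metric.ball (0 : ℝ) δ, ∀ x, 0 < m x + ε * v x := fun ε hε x => by
    by_cases hx : x ∈ tsupport v
    · linarith [hlow ε hε x hx]
    · rw [image_eq_zero_of_notMem_tsupport hx]
      simpa using hm x
  set L := max |Real.log (c / 2)| |Real.log (D + c / 2)| with hL
  have hint : ∀ ε : ℝ, hamiltonian 1 (m + ε • v)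
      = ∫ x, (m x + ε * v x) * Real.log (m x + ε * v x) := fun ε => by
    rw [hamiltonian, if_pos rfl]
    simp
  simp_rw [hint]
  have hmc := m.continuous
  have hvc := v.continuous
  have key := hasDerivAt_integral_of_dominated_loc_of_deriv_le (μ := (volume : Measure ℝ))
    (F := fun ε x => (m x + ε * v x) * Real.log (m x + ε * v x))
    (F' := fun ε x => (Real.log (m x + ε * v x) + 1) * v x) (x₀ := (0 : ℝ))
    (s := Metric.ball 0 δ) (bound := fun x => (L + 1) * |v x|) (Metric.ball_mem_nhds _ hδ0)
    (Eventually.of_forall fun ε => (Real.continuous_mul_log.comp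
      (by fun_prop : Continuous fun x => m x + ε * v x)).aestronglyMeasurable)
    (by simpa using integrable_mul_log m hm) ?_ ?_ ?_ ?_
  · simpa using key.2
  · have : Continuous fun x => Real.log (m x) := hmc.log fun x => (hm x).ne'
    simp only [zero_mul, add_zero]
    exact (by fun_prop : Continuous fun x => (Real.log (m x) + 1) * v x).aestronglyMeasurable
  · refine ae_of_all _ fun x ε hε => ?_
    by_cases hx : x ∈ tsupport v
    · rw [norm_mul, Real.norm_eq_abs, Real.norm_eq_abs]
      gcongr
      have h1 := hlow ε hε x hx
      have h2 : m x + ε * v x ≤ D + c / 2 := by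
        linarith [(abs_le.1 (hεv ε hε x)).2, le_abs_self (m x), hDm x]
      have h3 := Real.log_le_log (by positivity) h1
      have h4 := Real.log_le_log (hpos ε hε x) h2
      have h5 := neg_abs_le (Real.log (c / 2))
      have h6 := le_abs_self (Real.log (D + c / 2))
      have h7 : |Real.log (c / 2)| ≤ L := le_max_left _ _
      have h8 : |Real.log (D + c / 2)| ≤ L := le_max_right _ _
      rw [abs_le]
      constructor <;> linarith
    · simp [image_eq_zero_of_notMem_tsupport hx]
  · simpa using (integrable_one_add_abs_pow_mul v 0).const_mul (L + 1)
  · refine ae_of_all _ fun x ε hε => ?_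
    have h1 : HasDerivAt (fun ε : ℝ => m x + ε * v x) (v x) ε := by
      simpa using ((hasDerivAt_id ε).mul_const (v x)).const_add (m x)
    exact (Real.hasDerivAt_mul_log (hpos ε hε x).ne').comp ε h1

/-- In either case the variational derivative `η` of the Hamiltonian solves
`b m η' + (b - 1) m' η = m'`. -/
theorem exists_hasVarDeriv_hamiltonian {b : ℝ} {m : 𝓢(ℝ, ℝ)} (hm : m ∈ admissible b) :
    ∃ η, HasVarDeriv (hamiltonian b) m η ∧ mom b m η = deriv m := by
  by_cases hb : b = 1
  · subst hb
    have hpos : ∀ x, 0 < m x := hm rfl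
    refine ⟨_, hasVarDeriv_hamiltonian_one m hpos, funext fun x => ?_⟩
    have hd : HasDerivAt (fun x => Real.log (m x) + 1) (deriv m x / m x) x :=
      (m.differentiableAt.hasDerivAt.log (hpos x).ne').add_const 1
    rw [mom, hd.deriv]
    field_simp [(hpos x).ne']
    ring
  · refine ⟨_, hasVarDeriv_hamiltonian_of_ne_one hb m, funext fun x => ?_⟩
    have : b - 1 ≠ 0 := sub_ne_zero.2 hb
    rw [mom, deriv_const]
    field_simp
    ring

/-- The equation with velocity `u = U m` is Hamiltonian as soon as `U m = G * m'`. -/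
theorem hasHamiltonianForm_of_conv_deriv {G : ℝ → ℝ} (b : ℝ) {U : 𝓢(ℝ, ℝ) → ℝ → ℝ}
    (hU : ∀ m : 𝓢(ℝ, ℝ), conv G (deriv m) = U m) : HasHamiltonianForm G b U := by
  have hB : ∀ m ∈ admissible b, ∀ x, Bhat G b m (varDeriv (hamiltonian b) m) x
      = -(U m x * deriv m x + b * deriv (U m) x * m x) := fun m hm x => by
    obtain ⟨η, hη, hmom⟩ := exists_hasVarDeriv_hamiltonian hm
    rw [hη.varDeriv_eq, Bhat_eq, hmom, hU]
    ring
  refine ⟨fun m hm => ⟨?_, hB m hm⟩, fun I m hm => ?_⟩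
  · obtain ⟨η, hη, -⟩ := exists_hasVarDeriv_hamiltonian hm
    exact ⟨η, hη⟩
  · refine forall₂_congr fun t ht => forall_congr' fun x => and_congr_right fun _ => ?_
    rw [hB _ (hm t ht)]
    constructor <;> intro h <;> linarith

/-! ### Tempered kernels -/

theorem IsTempered.locallyIntegrable {g : ℝ → ℝ} (hg : IsTempered g) : LocallyIntegrable g := by
  obtain ⟨k, hk⟩ := hg
  refine locallyIntegrable_iff.2 fun K hK => ?_
  have h1 := hk.integrableOn (s := K)
  have h2 := h1.mul_continuousOn (g' := fun x => (1 + |x|) ^ k)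
    (by fun_prop : Continuous fun x : ℝ => (1 + |x|) ^ k).continuousOn hK
  refine h2.congr_fun (fun x _ => ?_) hK.measurableSet
  simp only
  have : (1 + |x|) ^ k ≠ 0 := by positivity
  field_simp

theorem abs_antideriv_le {g : ℝ → ℝ} {k : ℕ} (hk : Integrable (fun x => g x / (1 + |x|) ^ k))
    (t : ℝ) : |antideriv g t| ≤ (∫ x, |g x / (1 + |x|) ^ k|) * (1 + |t|) ^ k := by
  have h1 : |antideriv g t| ≤ ∫ x in Set.uIoc 0 t, |g x| := by
    rw [antideriv, ← Real.norm_eq_abs]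
    exact intervalIntegral.norm_integral_le_integral_norm_uIoc
  have hi := hk.abs.mul_const ((1 + |t|) ^ k)
  rw [← integral_mul_const]
  refine h1.trans (le_trans ?_ (setIntegral_le_integral hi (s := Set.uIoc 0 t)
    (ae_of_all _ fun x => by positivity)))
  refine setIntegral_mono_on ?_ hi.integrableOn measurableSet_uIoc fun x hx => ?_
  · exact (((IsTempered.locallyIntegrable ⟨k, hk⟩).integrableOn_isCompact
      isCompact_uIcc).mono_set Set.uIoc_subset_uIcc).abs
  · have hxt : |x| ≤ |t| := by
      rcases le_total 0 t with h | h
      · rw [Set.uIoc_of_le h] at hx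
        rw [abs_of_nonneg h, abs_of_pos hx.1]; exact hx.2
      · rw [Set.uIoc_of_ge h] at hx
        rw [abs_of_nonpos h, abs_of_nonpos hx.2]; linarith [hx.1]
    rw [abs_div, abs_of_pos (by positivity : 0 < (1 + |x|) ^ k), div_mul_eq_mul_div,
      le_div_iff₀ (by positivity)]
    gcongr

theorem one_add_abs_pow_le (x t : ℝ) (k : ℕ) :
    (1 + |t|) ^ k ≤ (1 + |x|) ^ k * (1 + |x - t|) ^ k := by
  rw [← mul_pow]
  gcongr
  have h : |t| ≤ |x| + |x - t| := by
    have := abs_sub x (x - t)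
    simpa using this
  nlinarith [abs_nonneg x, abs_nonneg (x - t), mul_nonneg (abs_nonneg x) (abs_nonneg (x - t))]

/-- For a tempered kernel, `G * m' = g * m`. -/
theorem conv_antideriv_deriv_schwartz {g : ℝ → ℝ} (hg : IsTempered g) (m : 𝓢(ℝ, ℝ)) :
    conv (antideriv g) (deriv m) = conv g m := by
  have hgl := hg.locallyIntegrable
  have hGc := continuous_antideriv hgl
  obtain ⟨k, hk⟩ := hg
  set N := ∫ x, |g x / (1 + |x|) ^ k|
  have hN : 0 ≤ N := integral_nonneg fun x => abs_nonneg _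
  have hmc := m.continuous
  ext x
  have hbd : ∀ (f : 𝓢(ℝ, ℝ)) t, |antideriv g t * f (x - t)|
      ≤ N * (1 + |x|) ^ k * ((1 + |x - t|) ^ k * |f (x - t)|) := fun f t => by
    rw [abs_mul]
    calc |antideriv g t| * |f (x - t)| ≤ N * (1 + |t|) ^ k * |f (x - t)| := by
          gcongr; exact abs_antideriv_le hk t
      _ ≤ N * ((1 + |x|) ^ k * (1 + |x - t|) ^ k) * |f (x - t)| := by
          gcongr; exact one_add_abs_pow_le x t k
      _ = _ := by ring
  have hz : Tendsto (fun t => antideriv g t * m (x - t)) (cocompact ℝ) (𝓝 0) := by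
    obtain ⟨C, hC, h⟩ := schwartz_decay m (k + 1)
    have hb : ∀ t, ‖antideriv g t * m (x - t)‖
        ≤ N * (1 + |x|) ^ k * (C * (1 + ‖x - t‖)⁻¹) := fun t => by
      refine (hbd m t).trans ?_
      refine mul_le_mul_of_nonneg_left ?_ (by positivity)
      rw [Real.norm_eq_abs, ← div_eq_mul_inv, le_div_iff₀ (by positivity)]
      calc (1 + |x - t|) ^ k * |m (x - t)| * (1 + |x - t|)
          = (1 + |x - t|) ^ (k + 1) * |m (x - t)| := by ring
        _ ≤ C := h (x - t)
    refine squeeze_zero_norm hb ?_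
    have t1 : Tendsto (fun t : ℝ => ‖x - t‖) (cocompact ℝ) atTop :=
      tendsto_norm_cocompact_atTop.comp (Homeomorph.subLeft x).isClosedEmbedding.tendsto_cocompact
    have t2 := (tendsto_atTop_add_const_left _ 1 t1).inv_tendsto_atTop
    simpa using (t2.const_mul C).const_mul (N * (1 + |x|) ^ k)
  refine conv_antideriv_deriv hgl ((m.smooth ⊤).of_le (by simp)) x ?_ ?_
    (hz.mono_left atTop_le_cocompact) (hz.mono_left atBot_le_cocompact)
  · have hi := (((integrable_one_add_abs_pow_mul (SchwartzMap.derivCLM ℝ ℝ m) k).comp_sub_left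
      x).const_mul (N * (1 + |x|) ^ k))
    have hc : Continuous (fun t => deriv m (x - t)) :=
      (SchwartzMap.derivCLM ℝ ℝ m).continuous.comp (continuous_sub_left x)
    exact hi.mono' (hGc.mul hc).aestronglyMeasurable
      (ae_of_all _ fun t => hbd (SchwartzMap.derivCLM ℝ ℝ m) t)
  · obtain ⟨C, hC, h⟩ := schwartz_decay m k
    have h2 := hk.bdd_mul (f := fun t => (1 + |t|) ^ k * m (x - t)) (c := (1 + |x|) ^ k * C)
      (by fun_prop : Continuous _).aestronglyMeasurable (ae_of_all _ fun t => ?_)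
    · refine h2.congr (ae_of_all _ fun t => ?_)
      simp only
      have : (1 + |t|) ^ k ≠ 0 := by positivity
      field_simp
    · rw [norm_mul, Real.norm_of_nonneg (by positivity), Real.norm_eq_abs]
      calc (1 + |t|) ^ k * |m (x - t)|
          ≤ (1 + |x|) ^ k * (1 + |x - t|) ^ k * |m (x - t)| := by
            gcongr; exact one_add_abs_pow_le x t k
        _ = (1 + |x|) ^ k * ((1 + |x - t|) ^ k * |m (x - t)|) := by ring
        _ ≤ (1 + |x|) ^ k * C := by gcongr; exact h (x - t)

open Filter Topology

theorem isTempered_const (A : ℝ) : IsTempered (fun _ => A) :=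
  ⟨2, by simpa [div_eq_mul_inv] using integrable_inv_one_add_abs_sq.const_mul A⟩

theorem isTempered_of_bounded {g : ℝ → ℝ} (hg : Continuous g) {C : ℝ} (h : ∀ x, |g x| ≤ C) :
    IsTempered g := by
  have := integrable_inv_one_add_abs_sq.bdd_mul hg.aestronglyMeasurable (ae_of_all _ h)
  exact ⟨2, by simpa [div_eq_mul_inv] using this⟩

/-! ### The peakon kernel -/

theorem even_peakonKernel (A B : ℝ) :
    Function.Even (fun t : ℝ => A * B * Real.exp (-B * |t|)) := fun x => by simp

theorem antideriv_peakonKernel (A B x : ℝ) :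
    antideriv (fun t => A * B * Real.exp (-B * |t|)) x
      = A * Real.sign x * (1 - Real.exp (-B * |x|)) := by
  have hpos : ∀ x, 0 ≤ x → antideriv (fun t => A * B * Real.exp (-B * |t|)) x
      = A * (1 - Real.exp (-B * x)) := fun x hx => by
    have h1 : antideriv (fun t => A * B * Real.exp (-B * |t|)) x
        = ∫ t in (0 : ℝ)..x, A * B * Real.exp (-B * t) := by
      refine intervalIntegral.integral_congr fun t ht => ?_
      rw [Set.uIcc_of_le hx] at ht
      simp only [abs_of_nonneg ht.1]
    have hd : ∀ t ∈ Set.uIcc 0 x, HasDerivAt (fun t => -A * Real.exp (-B * t))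
        (A * B * Real.exp (-B * t)) t := fun t _ => by
      have := ((hasDerivAt_id t).const_mul (-B)).exp.const_mul (-A)
      refine this.congr_deriv ?_
      simp only [id]; ring
    rw [h1, intervalIntegral.integral_eq_sub_of_hasDerivAt hd
      ((by fun_prop : Continuous fun t => A * B * Real.exp (-B * t)).intervalIntegrable _ _)]
    simp; ring
  rcases lt_trichotomy x 0 with hx | rfl | hx
  · have := antideriv_odd (even_peakonKernel A B) (-x)
    rw [neg_neg, hpos (-x) (by linarith)] at this
    rw [this, Real.sign_of_neg hx, abs_of_neg hx]; ring
  · simp [antideriv]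
  · rw [hpos x hx.le, Real.sign_of_pos hx, abs_of_pos hx]; ring

theorem threeTerm_cycle (G g : ℝ → ℝ) (α β γ : ℝ) : threeTerm G g α β γ = threeTerm G g β γ α := by
  simp only [threeTerm]; ring

theorem functionalEq_peakon (A B : ℝ) :
    FunctionalEq (antideriv (fun t => A * B * Real.exp (-B * |t|))) := by
  set g : ℝ → ℝ := fun t => A * B * Real.exp (-B * |t|) with hg
  have hgc : Continuous g := by fun_prop
  have hd : deriv (antideriv g) = g := funext fun x =>
    (intervalIntegral.integral_hasDerivAt_right (hgc.intervalIntegrable _ _)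
      (hgc.stronglyMeasurableAtFilter _ _) hgc.continuousAt).deriv
  have he : Function.Even g := even_peakonKernel A B
  have ho := antideriv_odd he
  have hG : ∀ x, 0 ≤ x → antideriv g x = A * (1 - Real.exp (-B * x)) := fun x hx => by
    rw [hg, antideriv_peakonKernel]
    rcases hx.eq_or_lt with rfl | hx
    · simp
    · rw [Real.sign_of_pos hx, abs_of_pos hx]; ring
  have hgp : ∀ x, 0 ≤ x → g x = A * B * Real.exp (-B * x) := fun x hx => by
    simp only [hg, abs_of_nonneg hx]
  -- it suffices to treat two arguments of the same sign: with `a = exp (-B α)` and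
  -- `b = exp (-B β)`, the equation is a polynomial identity in `a` and `b`
  have core : ∀ α β γ, α + β + γ = 0 → 0 ≤ α → 0 ≤ β → threeTerm (antideriv g) g α β γ = 0 := by
    intro α β γ hs hα hβ
    obtain rfl : γ = -(α + β) := by linarith
    rw [threeTerm, ho, he, hG α hα, hG β hβ, hG _ (add_nonneg hα hβ), hgp α hα, hgp β hβ,
      hgp _ (add_nonneg hα hβ), mul_add (-B), Real.exp_add]
    ring
  have core' : ∀ α β γ, α + β + γ = 0 → α ≤ 0 → β ≤ 0 → threeTerm (antideriv g) g α β γ = 0 := by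
    intro α β γ hs hα hβ
    have := core (-α) (-β) (-γ) (by linarith) (by linarith) (by linarith)
    simp only [threeTerm, ho _, he _] at this ⊢
    linarith
  intro α β γ hs
  rw [fe1_eq_threeTerm, hd]
  rcases le_total 0 α with hα | hα <;> rcases le_total 0 β with hβ | hβ
  · exact core _ _ _ hs hα hβ
  · rcases le_total 0 γ with hγ | hγ
    · rw [threeTerm_cycle, threeTerm_cycle]
      exact core _ _ _ (by linarith) hγ hα
    · rw [threeTerm_cycle]
      exact core' _ _ _ (by linarith) hβ hγ
  · rcases le_total 0 γ with hγ | hγ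
    · rw [threeTerm_cycle]
      exact core _ _ _ (by linarith) hβ hγ
    · rw [threeTerm_cycle, threeTerm_cycle]
      exact core' _ _ _ (by linarith) hγ hα
  · exact core' _ _ _ hs hα hβ

/-! ### The degenerate kernels -/

theorem antideriv_const (A : ℝ) : antideriv (fun _ => A) = fun x => A * x := by
  ext x
  simp [antideriv, mul_comm]

theorem functionalEq_linear (A : ℝ) : FunctionalEq (fun x => A * x) := by
  intro α β γ hs
  have hd : deriv (fun x => A * x) = fun _ => A := by
    ext x; simp
  rw [fe1, hd]
  linear_combination 2 * A ^ 2 * hs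

theorem monotone_sign : Monotone Real.sign := fun x y h => by
  rcases lt_trichotomy x 0 with hx | rfl | hx <;> rcases lt_trichotomy y 0 with hy | rfl | hy <;>
    first
    | (exfalso; linarith)
    | simp [Real.sign_of_neg, Real.sign_of_pos, Real.sign_zero, *]

theorem locallyIntegrable_sign (A : ℝ) : LocallyIntegrable (fun x => A * Real.sign x) :=
  monotone_sign.locallyIntegrable.smul A

theorem odd_sign (A : ℝ) : Function.Odd (fun x => A * Real.sign x) := fun x => by
  simp [Real.sign_neg]

/-- The derivative of `A sgn` is `2 A δ`. -/
theorem conv_sign_deriv (A : ℝ) {f f' : ℝ → ℝ} (hf : ∀ x, HasDerivAt f (f' x) x)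
    (hi : Integrable f') (h0 : Tendsto f (cocompact ℝ) (𝓝 0)) (x : ℝ) :
    conv (fun x => A * Real.sign x) f' x = 2 * A * f x := by
  have e1 : ∫ y in Set.Iic x, f' y = f x - 0 :=
    integral_Iic_of_hasDerivAt_of_tendsto' (fun y _ => hf y) hi.integrableOn
      (h0.mono_left atBot_le_cocompact)
  have e2 : ∫ y in Set.Ioi x, f' y = 0 - f x :=
    integral_Ioi_of_hasDerivAt_of_tendsto' (fun y _ => hf y) hi.integrableOn
      (h0.mono_left atTop_le_cocompact)
  have s1 : ∫ y in Set.Iic x, A * Real.sign (x - y) * f' y = ∫ y in Set.Iic x, A * f' y := by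
    rw [integral_Iic_eq_integral_Iio, integral_Iic_eq_integral_Iio]
    refine setIntegral_congr_fun measurableSet_Iio fun y hy => ?_
    rw [Real.sign_of_pos (sub_pos.2 hy), mul_one]
  have s2 : ∫ y in Set.Ioi x, A * Real.sign (x - y) * f' y = ∫ y in Set.Ioi x, -A * f' y := by
    refine setIntegral_congr_fun measurableSet_Ioi fun y hy => ?_
    rw [Real.sign_of_neg (sub_neg.2 hy)]; ring
  have hm : Measurable fun y => A * Real.sign (x - y) :=
    (monotone_sign.measurable.comp (measurable_const.sub measurable_id)).const_mul A
  have hint : Integrable (fun y => A * Real.sign (x - y) * f' y) := by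
    refine hi.bdd_mul (c := |A|) hm.aestronglyMeasurable (ae_of_all _ fun y => ?_)
    rw [norm_mul, Real.norm_eq_abs, Real.norm_eq_abs]
    rcases Real.sign_apply_eq (x - y) with h | h | h <;> simp [h]
  rw [conv, ← intervalIntegral.integral_Iic_add_Ioi hint.integrableOn hint.integrableOn, s1, s2,
    integral_const_mul, integral_const_mul, e1, e2]
  ring

theorem jacobi_sign (A b : ℝ) : JacobiIdentity (fun x => A * Real.sign x) b := by
  intro φ ψ χ hφ hψ hχ m
  have hl := locallyIntegrable_sign A
  rw [jacobiator_eq_neg_triForm b hl (odd_sign A) hφ hψ hχ, neg_eq_zero]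
  have hd : ∀ {f : ℝ → ℝ}, IsTest f →
      deriv (conv (fun x => A * Real.sign x) f) = fun x => 2 * A * f x := fun {f} hf => by
    rw [deriv_conv hl hf]
    exact funext (conv_sign_deriv A (fun x => (hf.differentiable x).hasDerivAt) hf.deriv.integrable
      hf.2.is_zero_at_infty)
  have a1 := isTest_mom b (m.smooth ⊤) hφ
  have a2 := isTest_mom b (m.smooth ⊤) hψ
  have a3 := isTest_mom b (m.smooth ⊤) hχ
  generalize mom b m φ = f₁ at *
  generalize mom b m ψ = f₂ at *
  generalize mom b m χ = f₃ at *
  rw [triForm, hd a1, hd a2, hd a3]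
  have u1 := conv_contDiff hl a1
  have u2 := conv_contDiff hl a2
  have u3 := conv_contDiff hl a3
  -- the trilinear form is the integral of an expression that vanishes identically
  have i : ∀ {f h k U V : ℝ → ℝ}, IsTest f → IsTest h → IsTest k → ContDiff ℝ ∞ U →
      ContDiff ℝ ∞ V →
      Integrable (fun x => f x * (U x * (2 * A * h x) - V x * (2 * A * k x))) :=
    fun hf hh hk hU hV =>
      (hf.mul_right ((hU.mul (hh.const_mul _).1).sub (hV.mul (hk.const_mul _).1))).integrable
  rw [← integral_add (i a1 a3 a2 u2 u3) (i a2 a1 a3 u3 u1),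
    ← integral_add ((i a1 a3 a2 u2 u3).fun_add (i a2 a1 a3 u3 u1)) (i a3 a2 a1 u1 u2)]
  refine integral_eq_zero_of_ae (ae_of_all _ fun x => ?_)
  simp only [Pi.zero_apply]
  ring

end NonlocalBracket

end

open NonlocalBracket in
theorem mainTheorem1 (b : ℝ) :
    -- the bracket: it is well defined on fields and on brackets of fields, skew, and given by
    -- the stated kernel
    (∀ G : ℝ → ℝ, Function.Odd G → LocallyIntegrable G →
      ∀ φ ψ : ℝ → ℝ, IsTest φ → IsTest ψ → ∀ m : 𝓢(ℝ, ℝ),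
        HasVarDeriv (field φ) m φ ∧
        (∃ η, IsTest η ∧ HasVarDeriv (bracket G b (field φ) (field ψ)) m η) ∧
        bracket G b (field φ) (field ψ) m = -bracket G b (field ψ) (field φ) m ∧
        bracket G b (field φ) (field ψ) m = bracketKernelPair G b m φ ψ ∧
        (ContDiff ℝ 2 G → bracket G b (field φ) (field ψ) m
          = ∫ x, ∫ y, φ x * ψ y * bracketKernel G b m x y)) ∧
    -- the Jacobi identity and the functional equations
    (∀ g : ℝ → ℝ, Function.Even g → LocallyIntegrable g →
      (JacobiIdentity (antideriv g) b ↔ FunctionalEqAE (antideriv g)) ∧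
      (Continuous g → (JacobiIdentity (antideriv g) b ↔ FunctionalEq (antideriv g))) ∧
      (FunctionalEqAE (antideriv g) → ∀ α β γ : ℝ, α + β + γ = 0 →
        ((∀ x ∈ ({α, β, γ} : Set ℝ), ContDiffAt ℝ 2 (antideriv g) x) →
          fe2 (antideriv g) α β γ = 0) ∧
        ((∀ x ∈ ({α, β, γ} : Set ℝ), ContDiffAt ℝ 3 (antideriv g) x) →
          fe3 (antideriv g) α β γ = 0 ∧ fe4 (antideriv g) α β γ = 0))) ∧
    -- the Hamiltonian form of the equation
    (∀ g : ℝ → ℝ, Function.Even g → IsTempered g →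
      HasHamiltonianForm (antideriv g) b (fun m => conv g m)) ∧
    -- the peakon kernel
    (∀ A B : ℝ,
      (∀ x, antideriv (fun t => A * B * Real.exp (-B * |t|)) x
        = A * Real.sign x * (1 - Real.exp (-B * |x|))) ∧
      JacobiIdentity (fun x => A * Real.sign x * (1 - Real.exp (-B * |x|))) b ∧
      (0 < B → HasHamiltonianForm (fun x => A * Real.sign x * (1 - Real.exp (-B * |x|))) b
        (fun m => conv (fun t => A * B * Real.exp (-B * |t|)) m))) ∧
    -- its degenerations: `G = A x`, `g = A`, and `G = A sgn x`, `g = 2 A δ`, `u = 2 A m`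
    (∀ A : ℝ,
      JacobiIdentity (fun x => A * x) b ∧
      HasHamiltonianForm (fun x => A * x) b (fun m => conv (fun _ => A) m) ∧
      JacobiIdentity (fun x => A * Real.sign x) b ∧
      HasHamiltonianForm (fun x => A * Real.sign x) b (fun m x => 2 * A * m x)) := by
  have hcont : ∀ {g : ℝ → ℝ}, Function.Even g → Continuous g →
      (JacobiIdentity (antideriv g) b ↔ FunctionalEq (antideriv g)) := fun he hc =>
    (jacobi_iff_functionalEqAE b he hc.locallyIntegrable).trans
      (functionalEq_of_ae_of_continuous hc)
  refine ⟨fun G ho hG φ ψ hφ hψ m => ⟨hasVarDeriv_field hφ m,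
      ⟨_, isTest_bracketGrad b hG (m.smooth ⊤) hφ hψ, hasVarDeriv_bracket b hG ho hφ hψ m⟩,
      bracket_field_skew b hG ho hφ hψ m, bracket_field_eq_kernelPair b hG hφ hψ m,
      fun h2 => bracket_field_eq_integral b h2 hφ hψ m⟩,
    fun g he hg => ⟨jacobi_iff_functionalEqAE b he hg, hcont he, fun h α β γ hs => ⟨fun hC => ?_,
      fun hC => ?_⟩⟩,
    fun g _ hg => hasHamiltonianForm_of_conv_deriv b (conv_antideriv_deriv_schwartz hg),
    fun A B => ?_, fun A => ⟨?_, ?_, jacobi_sign A b, ?_⟩⟩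
  · exact fe2_eq_zero h hs (hC α (by simp)) (hC β (by simp)) (hC γ (by simp))
  · exact ⟨fe3_eq_zero h hs (hC α (by simp)) (hC β (by simp)) (hC γ (by simp)),
      fe4_eq_zero (continuous_antideriv hg) h hs (hC α (by simp)) (hC β (by simp))
        (hC γ (by simp))⟩
  · have hgc : Continuous (fun t : ℝ => A * B * Real.exp (-B * |t|)) := by fun_prop
    have hG := funext (antideriv_peakonKernel A B)
    rw [← hG]
    refine ⟨fun x => by rw [hG], (hcont (even_peakonKernel A B) hgc).2 (functionalEq_peakon A B),
      fun hB => hasHamiltonianForm_of_conv_deriv b (conv_antideriv_deriv_schwartz ?_)⟩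
    refine isTempered_of_bounded hgc (C := |A * B|) fun x => ?_
    rw [abs_mul, abs_of_pos (Real.exp_pos _)]
    refine mul_le_of_le_one_right (abs_nonneg _) (Real.exp_le_one_iff.2 ?_)
    rw [neg_mul]
    exact neg_nonpos.2 (by positivity)
  · rw [← antideriv_const]
    refine (hcont (fun _ => rfl) continuous_const).2 ?_
    rw [antideriv_const]
    exact functionalEq_linear A
  · rw [← antideriv_const]
    exact hasHamiltonianForm_of_conv_deriv b (conv_antideriv_deriv_schwartz (isTempered_const A))
  · exact hasHamiltonianForm_of_conv_deriv b fun m => funext (conv_sign_deriv A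
      (fun x => m.differentiableAt.hasDerivAt) (SchwartzMap.derivCLM ℝ ℝ m).integrable
      m.tendsto_cocompact)
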